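/- Let $k$ be a field of characteristic $0$ and $\delta\in k$. A (noncommutative) transposed $\delta$-Leibniz–Poisson algebra is a $k$-vector space with an associative product $xy$ and a bilinear bracket $\{x,y\}$ satisfying the (left) Leibniz identity and the compatibility identity \[ \{\{x,y\},z\}=\{x,\{y,z\}\}-\{y,\{x,z\}\},\qquad \delta\, x\{y,z\}=\{xy,z\}+\{y,xz\}. \] Let $\mathcal P_\delta=\mathcal P(E,R)$ be the binary quadratic operad governing these algebras, where $E$ is the $S_2$-module with basis $e_1=x_1x_2,\ e_2=x_2x_1,\ g_1=\{x_1,x_2\},\ g_2=\{x_2,x_1\}$ and $R\subset \mathcal F(E)(3)$ is the $S_3$-submodule generated by the three identities. Let $\mathcal P_\delta^!=\mathcal P(E^\vee,R^\perp)$ be its Koszul dual operad, where $E^\vee=E^*\otimes\mathrm{sgn}$ and $R^\perp\subset\mathcal F(E^\vee)(3)$ is the orthogonal complement of $R$ under the canonical pairing. Denote by $\cdot$ and $\star$ the elements $e_1^\vee$ and $g_1^\vee$ of the basis of $E^\vee$ dual to $e_1,e_2,g_1,g_2$ (so that $e_2^\vee$ and $g_2^\vee$ are the negatives of the opposite operations).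 Proposition. The operad $\mathcal P_\delta^!$ is presented by the two binary operations $\cdot$ and $\star$ (without symmetry) and the following identities; consequently, a $\mathcal P_\delta^!$-algebra is the same as a $k$-vector space with two bilinear operations $\cdot$ and $\star$ satisfying them: 1. $\cdot$ is associative: $(xy)z=x(yz)$; 2. $\star$ is Zinbiel: $x\star(y\star z)=(x\star y)\star z+(y\star x)\star z$; 3. if $\delta\neq0$: $x(y\star z)=\delta\,(xy)\star z$, $\;x(y\star z)=\delta\, y\star(xz)$ and $(x\star y)z=0$; 4. if $\delta=0$: $(x\star y)z=x(y\star z)=0$ and $y\star(xz)=(xy)\star z$. -/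

import Mathlib

open scoped TensorProduct

noncomputable section

/-! ### Symmetric operads, in their coordinate-free form

An operad assigns to every finite set `S` the module `obj S` of operations whose inputs are
labelled by `S`; `map` relabels the inputs and `comp p q` plugs `q s` into the input `s` of `p`. -/

universe u v w

/-- A symmetric operad in `k`-modules. -/
structure SymOperad (k : Type u) [Field k] where
  obj : (S : Type) → [Finite S] → Type v
  [grp : ∀ (S : Type) [Finite S], AddCommGroup (obj S)]
  [mod : ∀ (S : Type) [Finite S], Module k (obj S)]
  map : ∀ {S T : Type} [Finite S] [Finite T], (S ≃ T) → obj S →ₗ[k] obj T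
  one : obj Unit
  comp : ∀ {S : Type} [Finite S] {T : S → Type} [∀ s, Finite (T s)],
    obj S →ₗ[k] MultilinearMap k (fun s => obj (T s)) (obj (Σ s, T s))
  map_refl : ∀ {S : Type} [Finite S] (p : obj S), map (Equiv.refl S) p = p
  map_trans : ∀ {S T U : Type} [Finite S] [Finite T] [Finite U] (e : S ≃ T) (f : T ≃ U)
    (p : obj S), map (e.trans f) p = map f (map e p)
  comp_map_left : ∀ {S S' : Type} [Finite S] [Finite S'] {T : S' → Type} [∀ s, Finite (T s)]
    (e : S ≃ S') (p : obj S) (q : ∀ s, obj (T s)),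
    comp (map e p) q = map (Equiv.sigmaCongrLeft e) (comp p (fun s => q (e s)))
  comp_map_right : ∀ {S : Type} [Finite S] {T T' : S → Type} [∀ s, Finite (T s)]
    [∀ s, Finite (T' s)] (e : ∀ s, T s ≃ T' s) (p : obj S) (q : ∀ s, obj (T s)),
    comp p (fun s => map (e s) (q s)) = map (Equiv.sigmaCongrRight e) (comp p q)
  one_comp : ∀ {T : Unit → Type} [∀ s, Finite (T s)] (q : ∀ s, obj (T s)),
    comp one q = map (Equiv.uniqueSigma T).symm (q ())
  comp_one : ∀ {S : Type} [Finite S] (p : obj S),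
    comp p (fun _ => one) = map (Equiv.sigmaUnique S (fun _ => Unit)).symm p
  comp_assoc : ∀ {S : Type} [Finite S] {T : S → Type} [∀ s, Finite (T s)]
    {U : ∀ s, T s → Type} [∀ s t, Finite (U s t)]
    (p : obj S) (q : ∀ s, obj (T s)) (r : ∀ s t, obj (U s t)),
    map (Equiv.sigmaAssoc U) (comp (comp p q) (fun x => r x.1 x.2)) =
      comp p (fun s => comp (q s) (r s))

attribute [instance] SymOperad.grp SymOperad.mod

namespace SymOperad

variable {k : Type u} [Field k]

/-- Morphisms of operads. -/
structure Hom (P : SymOperad.{u, v} k) (Q : SymOperad.{u, w} k) where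
  app : ∀ (S : Type) [Finite S], P.obj S →ₗ[k] Q.obj S
  app_map : ∀ {S T : Type} [Finite S] [Finite T] (e : S ≃ T) (p : P.obj S),
    app T (P.map e p) = Q.map e (app S p)
  app_one : app Unit P.one = Q.one
  app_comp : ∀ {S : Type} [Finite S] {T : S → Type} [∀ s, Finite (T s)]
    (p : P.obj S) (q : ∀ s, P.obj (T s)),
    app (Σ s, T s) (P.comp p q) = Q.comp (app S p) (fun s => app (T s) (q s))

/-- A morphism of operads is an isomorphism when all its components are bijective. -/
def Hom.IsIso {P : SymOperad.{u, v} k} {Q : SymOperad.{u, w} k} (f : Hom P Q) : Prop :=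
  ∀ (S : Type) [Finite S], Function.Bijective (f.app S)

/-! #### The endomorphism operad -/

/-- The endomorphism operad of a `k`-module `V`: an element of arity `S` is a multilinear
operation in variables indexed by `S`. -/
def endOperad (k : Type u) [Field k] (V : Type v) [AddCommGroup V] [Module k V] :
    SymOperad.{u, v} k where
  obj S _ := MultilinearMap k (fun _ : S => V) V
  map e := (MultilinearMap.domDomCongrLinearEquiv k k V V e).toLinearMap
  one := MultilinearMap.ofSubsingleton k V V () LinearMap.id
  comp :=
    { toFun := fun p =>
        { toFun := fun q => p.compMultilinearMap q
          map_update_add' := by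
            intro _ q i a b
            ext x
            have h : ∀ c, (fun j => (Function.update q i c) j (fun t => x ⟨j, t⟩)) =
                Function.update (fun j => q j (fun t => x ⟨j, t⟩)) i (c (fun t => x ⟨i, t⟩)) := by
              intro c
              funext j
              exact Function.apply_update (fun j g => g (fun t => x ⟨j, t⟩)) q i c j
            change p (fun j => (Function.update q i (a + b)) j (fun t => x ⟨j, t⟩)) =
              p (fun j => (Function.update q i a) j (fun t => x ⟨j, t⟩)) +
              p (fun j => (Function.update q i b) j (fun t => x ⟨j, t⟩))
            rw [h, h, h]
            exact p.map_update_add _ _ _ _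
          map_update_smul' := by
            intro _ q i c a
            ext x
            have h : ∀ c, (fun j => (Function.update q i c) j (fun t => x ⟨j, t⟩)) =
                Function.update (fun j => q j (fun t => x ⟨j, t⟩)) i (c (fun t => x ⟨i, t⟩)) := by
              intro c
              funext j
              exact Function.apply_update (fun j g => g (fun t => x ⟨j, t⟩)) q i c j
            change p (fun j => (Function.update q i (c • a)) j (fun t => x ⟨j, t⟩)) =
              c • p (fun j => (Function.update q i a) j (fun t => x ⟨j, t⟩))
            rw [h, h]
            exact p.map_update_smul _ _ _ _ }
      map_add' := fun _ _ => rfl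
      map_smul' := fun _ _ => rfl }
  map_refl _ := rfl
  map_trans _ _ _ := rfl
  comp_map_left {S S'} _ _ T _ e p q := by
    ext x
    change p (fun i => q (e i) _) = p (fun i => q (e i) _)
    rfl
  comp_map_right _ _ _ := rfl
  one_comp _ := rfl
  comp_one _ := rfl
  comp_assoc _ _ _ := rfl

/-! #### Operadic ideals and quotients -/

/-- An ideal of an operad: submodules stable under relabelling, containing every composite of
which at least one factor lies in the ideal. -/
structure Ideal (P : SymOperad.{u, v} k) where
  carrier : ∀ (S : Type) [Finite S], Submodule k (P.obj S)
  map_mem : ∀ {S T : Type} [Finite S] [Finite T] (e : S ≃ T) {p : P.obj S},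
    p ∈ carrier S → P.map e p ∈ carrier T
  comp_left_mem : ∀ {S : Type} [Finite S] {T : S → Type} [∀ s, Finite (T s)] {p : P.obj S}
    (q : ∀ s, P.obj (T s)), p ∈ carrier S → P.comp p q ∈ carrier (Σ s, T s)
  comp_right_mem : ∀ {S : Type} [Finite S] {T : S → Type} [∀ s, Finite (T s)] (p : P.obj S)
    (q : ∀ s, P.obj (T s)) (s : S), q s ∈ carrier (T s) → P.comp p q ∈ carrier (Σ s, T s)

/-- The ideal generated by a family of sets of operations (the smallest one containing it). -/
def idealSpan (P : SymOperad.{u, v} k) (A : ∀ (S : Type) [Finite S], Set (P.obj S)) :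
    P.Ideal where
  carrier S _ := ⨅ (J : P.Ideal) (_ : ∀ (S : Type) [Finite S], A S ⊆ J.carrier S), J.carrier S
  map_mem e p hp := by
    simp only [Submodule.mem_iInf] at hp ⊢
    exact fun J hJ => J.map_mem e (hp J hJ)
  comp_left_mem q hp := by
    simp only [Submodule.mem_iInf] at hp ⊢
    exact fun J hJ => J.comp_left_mem q (hp J hJ)
  comp_right_mem p q s hq := by
    simp only [Submodule.mem_iInf] at hq ⊢
    exact fun J hJ => J.comp_right_mem p q s (hq J hJ)

namespace Ideal

variable {P : SymOperad.{u, v} k} (I : P.Ideal)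

theorem comp_sub_mem {S : Type} [Finite S] {T : S → Type} [∀ s, Finite (T s)]
    {p p' : P.obj S} {q q' : ∀ s, P.obj (T s)} (hp : p - p' ∈ I.carrier S)
    (hq : ∀ s, q s - q' s ∈ I.carrier (T s)) :
    P.comp p q - P.comp p' q' ∈ I.carrier (Σ s, T s) := by
  classical
  have := Fintype.ofFinite S
  have key : ∀ A : Finset S,
      P.comp p' (A.piecewise q q') - P.comp p' q' ∈ I.carrier (Σ s, T s) := by
    intro A
    induction A using Finset.induction_on with
    | empty => simp
    | insert a A ha ih =>
      rw [Finset.piecewise_insert]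
      have h1 : A.piecewise q q' = Function.update (A.piecewise q q') a (q' a) := by
        rw [eq_comm, Function.update_eq_self_iff, Finset.piecewise_eq_of_notMem _ _ _ ha]
      have h2 : P.comp p' (Function.update (A.piecewise q q') a (q a)) -
          P.comp p' (A.piecewise q q') ∈ I.carrier (Σ s, T s) := by
        nth_rewrite 2 [h1]
        rw [← MultilinearMap.map_update_sub]
        refine I.comp_right_mem _ _ a ?_
        simpa using hq a
      simpa using add_mem h2 ih
  have h1 : P.comp p q - P.comp p' q ∈ I.carrier (Σ s, T s) := by
    have := I.comp_left_mem q hp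
    simpa using this
  have h2 := key Finset.univ
  rw [Finset.piecewise_univ] at h2
  simpa using add_mem h1 h2

/-- Composition on the quotient, computed on representatives. -/
def quotCompFun {S : Type} [Finite S] {T : S → Type} [∀ s, Finite (T s)]
    (p : P.obj S ⧸ I.carrier S) (q : ∀ s, P.obj (T s) ⧸ I.carrier (T s)) :
    P.obj (Σ s, T s) ⧸ I.carrier (Σ s, T s) :=
  Submodule.Quotient.mk (P.comp (Quotient.out p) (fun s => Quotient.out (q s)))

theorem quotCompFun_mk {S : Type} [Finite S] {T : S → Type} [∀ s, Finite (T s)]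
    (p : P.obj S) (q : ∀ s, P.obj (T s)) :
    I.quotCompFun (Submodule.Quotient.mk p) (fun s => Submodule.Quotient.mk (q s)) =
      Submodule.Quotient.mk (P.comp p q) := by
  refine (Submodule.Quotient.eq _).2 (I.comp_sub_mem ?_ fun s => ?_)
  · exact (Submodule.Quotient.eq _).1 (Quotient.out_eq _)
  · exact (Submodule.Quotient.eq _).1 (Quotient.out_eq _)

theorem exists_mk {S : Type} {T : S → Type} [∀ s, Finite (T s)]
    (q : ∀ s, P.obj (T s) ⧸ I.carrier (T s)) :
    ∃ q' : ∀ s, P.obj (T s), q = fun s => Submodule.Quotient.mk (q' s) :=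
  ⟨fun s => Quotient.out (q s), funext fun _ => (Quotient.out_eq _).symm⟩

/-- Composition on the quotient, as a multilinear map. -/
def quotComp {S : Type} [Finite S] {T : S → Type} [∀ s, Finite (T s)] :
    (P.obj S ⧸ I.carrier S) →ₗ[k] MultilinearMap k (fun s => P.obj (T s) ⧸ I.carrier (T s))
      (P.obj (Σ s, T s) ⧸ I.carrier (Σ s, T s)) where
  toFun p :=
    { toFun := fun q => I.quotCompFun p q
      map_update_add' := by
        intro _ q i a b
        obtain ⟨p, rfl⟩ := Submodule.Quotient.mk_surjective _ p
        obtain ⟨q, rfl⟩ := I.exists_mk q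
        obtain ⟨a, rfl⟩ := Submodule.Quotient.mk_surjective _ a
        obtain ⟨b, rfl⟩ := Submodule.Quotient.mk_surjective _ b
        have h : ∀ c : P.obj (T i), Function.update (fun s => (Submodule.Quotient.mk (q s) :
            P.obj (T s) ⧸ I.carrier (T s))) i (Submodule.Quotient.mk c) =
            fun s => Submodule.Quotient.mk (Function.update q i c s) := fun c => by
          funext s
          exact (Function.apply_update
            (fun s (x : P.obj (T s)) => (Submodule.Quotient.mk x : _ ⧸ I.carrier (T s)))
            q i c s).symm
        rw [← Submodule.Quotient.mk_add, h, h, h, quotCompFun_mk, quotCompFun_mk,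
          quotCompFun_mk, MultilinearMap.map_update_add, Submodule.Quotient.mk_add]
      map_update_smul' := by
        intro _ q i c a
        obtain ⟨p, rfl⟩ := Submodule.Quotient.mk_surjective _ p
        obtain ⟨q, rfl⟩ := I.exists_mk q
        obtain ⟨a, rfl⟩ := Submodule.Quotient.mk_surjective _ a
        have h : ∀ c : P.obj (T i), Function.update (fun s => (Submodule.Quotient.mk (q s) :
            P.obj (T s) ⧸ I.carrier (T s))) i (Submodule.Quotient.mk c) =
            fun s => Submodule.Quotient.mk (Function.update q i c s) := fun c => by
          funext s
          exact (Function.apply_update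
            (fun s (x : P.obj (T s)) => (Submodule.Quotient.mk x : _ ⧸ I.carrier (T s)))
            q i c s).symm
        rw [← Submodule.Quotient.mk_smul, h, h, quotCompFun_mk, quotCompFun_mk,
          MultilinearMap.map_update_smul, Submodule.Quotient.mk_smul] }
  map_add' p p' := by
    ext q
    obtain ⟨p, rfl⟩ := Submodule.Quotient.mk_surjective _ p
    obtain ⟨p', rfl⟩ := Submodule.Quotient.mk_surjective _ p'
    obtain ⟨q, rfl⟩ := I.exists_mk q
    change I.quotCompFun _ _ = I.quotCompFun _ _ + I.quotCompFun _ _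
    rw [← Submodule.Quotient.mk_add, quotCompFun_mk, quotCompFun_mk, quotCompFun_mk, map_add]
    rfl
  map_smul' c p := by
    ext q
    obtain ⟨p, rfl⟩ := Submodule.Quotient.mk_surjective _ p
    obtain ⟨q, rfl⟩ := I.exists_mk q
    change I.quotCompFun _ _ = c • I.quotCompFun _ _
    rw [← Submodule.Quotient.mk_smul, quotCompFun_mk, quotCompFun_mk, map_smul]
    rfl

theorem quotComp_mk {S : Type} [Finite S] {T : S → Type} [∀ s, Finite (T s)]
    (p : P.obj S) (q : ∀ s, P.obj (T s)) :
    I.quotComp (Submodule.Quotient.mk p) (fun s => Submodule.Quotient.mk (q s)) =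
      Submodule.Quotient.mk (P.comp p q) :=
  I.quotCompFun_mk p q

/-- The quotient of an operad by an ideal. -/
def quotient : SymOperad.{u, v} k where
  obj S _ := P.obj S ⧸ I.carrier S
  map {S T} _ _ e := (I.carrier S).mapQ (I.carrier T) (P.map e) (fun _ hp => I.map_mem e hp)
  one := Submodule.Quotient.mk P.one
  comp := I.quotComp
  map_refl p := by
    obtain ⟨p, rfl⟩ := Submodule.Quotient.mk_surjective _ p
    simp [P.map_refl]
  map_trans e f p := by
    obtain ⟨p, rfl⟩ := Submodule.Quotient.mk_surjective _ p
    simp [P.map_trans]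
  comp_map_left e p q := by
    obtain ⟨p, rfl⟩ := Submodule.Quotient.mk_surjective _ p
    obtain ⟨q, rfl⟩ := I.exists_mk q
    simp only [Submodule.mapQ_apply, quotComp_mk, P.comp_map_left]
  comp_map_right e p q := by
    obtain ⟨p, rfl⟩ := Submodule.Quotient.mk_surjective _ p
    obtain ⟨q, rfl⟩ := I.exists_mk q
    simp only [Submodule.mapQ_apply, quotComp_mk, P.comp_map_right]
  one_comp q := by
    obtain ⟨q, rfl⟩ := I.exists_mk q
    simp only [Submodule.mapQ_apply, quotComp_mk, P.one_comp]
  comp_one p := by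
    obtain ⟨p, rfl⟩ := Submodule.Quotient.mk_surjective _ p
    simp only [Submodule.mapQ_apply, quotComp_mk, P.comp_one]
  comp_assoc p q r := by
    obtain ⟨p, rfl⟩ := Submodule.Quotient.mk_surjective _ p
    obtain ⟨q, rfl⟩ := I.exists_mk q
    have hr : ∃ r' : ∀ s t, P.obj _, r = fun s t => Submodule.Quotient.mk (r' s t) :=
      ⟨fun s t => Quotient.out (r s t), funext fun _ => funext fun _ => (Quotient.out_eq _).symm⟩
    obtain ⟨r, rfl⟩ := hr
    simp only [Submodule.mapQ_apply, quotComp_mk]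
    rw [P.comp_assoc]

end Ideal

end SymOperad

/-! ### The free operad on a set of binary operations -/

/-- Binary trees with internal vertices labelled by `E` and leaves labelled by `X`. -/
inductive OpTree (E : Type u) (X : Type) : Type u
  | leaf : X → OpTree E X
  | node : E → OpTree E X → OpTree E X → OpTree E X

namespace OpTree

variable {E : Type u} {X Y Z : Type}

def leaves : OpTree E X → List X
  | leaf x => [x]
  | node _ t t' => t.leaves ++ t'.leaves

/-- Substitution of trees for the leaves. -/
def bind : OpTree E X → (X → OpTree E Y) → OpTree E Y
  | leaf x, f => f x
  | node e t t', f => node e (t.bind f) (t'.bind f)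

def map (f : X → Y) (t : OpTree E X) : OpTree E Y := t.bind fun x => leaf (f x)

theorem leaves_bind (t : OpTree E X) (f : X → OpTree E Y) :
    (t.bind f).leaves = t.leaves.flatMap fun x => (f x).leaves := by
  induction t with
  | leaf x => simp [bind, leaves]
  | node e t t' h h' => simp [bind, leaves, h, h']

theorem leaves_map (f : X → Y) (t : OpTree E X) : (t.map f).leaves = t.leaves.map f := by
  induction t with
  | leaf x => rfl
  | node e t t' h h' =>
    change (t.map f).leaves ++ (t'.map f).leaves = (t.leaves ++ t'.leaves).map f
    rw [h, h', List.map_append]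

theorem bind_bind (t : OpTree E X) (f : X → OpTree E Y) (g : Y → OpTree E Z) :
    (t.bind f).bind g = t.bind fun x => (f x).bind g := by
  induction t with
  | leaf x => rfl
  | node e t t' h h' => simp [bind, h, h']

theorem bind_leaf (t : OpTree E X) : t.bind leaf = t := by
  induction t with
  | leaf x => rfl
  | node e t t' h h' => simp [bind, h, h']

end OpTree

/-- Multilinear tree monomials: every label in `S` occurs on exactly one leaf. -/
def MTree (E : Type u) (S : Type) : Type u :=
  {t : OpTree E S // t.leaves.Nodup ∧ ∀ s, s ∈ t.leaves}

namespace MTree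

variable {E : Type u}

def map {S T : Type} (e : S ≃ T) (t : MTree E S) : MTree E T :=
  ⟨t.1.map e, by
    rw [OpTree.leaves_map]
    refine ⟨t.2.1.map e.injective, fun s => ?_⟩
    exact List.mem_map.2 ⟨e.symm s, t.2.2 _, e.apply_symm_apply s⟩⟩

/-- Grafting: the tree `u s` is glued at the leaf `s` of `t`. -/
def graft {S : Type} {T : S → Type} (t : MTree E S) (u : ∀ s, MTree E (T s)) :
    MTree E (Σ s, T s) :=
  ⟨t.1.bind fun s => (u s).1.map (Sigma.mk s), by
    rw [OpTree.leaves_bind]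
    simp only [OpTree.leaves_map]
    constructor
    · rw [List.nodup_flatMap]
      refine ⟨fun s _ => (u s).2.1.map sigma_mk_injective, ?_⟩
      refine t.2.1.imp ?_
      intro a b hab x hx hx'
      obtain ⟨y, _, rfl⟩ := List.mem_map.1 hx
      obtain ⟨z, _, hz⟩ := List.mem_map.1 hx'
      exact hab (congrArg Sigma.fst hz).symm
    · rintro ⟨s, x⟩
      exact List.mem_flatMap.2 ⟨s, t.2.2 s, List.mem_map.2 ⟨x, (u s).2.2 x, rfl⟩⟩⟩

def one : MTree E Unit := ⟨OpTree.leaf (), by simp [OpTree.leaves]⟩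

/-- The operation `e`, as the tree with one vertex: `x₀ e x₁`. -/
def corolla (e : E) : MTree E (Fin 2) :=
  ⟨.node e (.leaf 0) (.leaf 1), by simp [OpTree.leaves, Fin.forall_fin_two]⟩

/-- The monomial `(x_{j+1} f x_{j+2}) e x_j`, with indices modulo `3`. -/
def cubic (j : Fin 3) (e f : E) : MTree E (Fin 3) :=
  ⟨.node e (.node f (.leaf (j + 1)) (.leaf (j + 2))) (.leaf j), by
    revert j; simp only [OpTree.leaves]; decide⟩

end MTree

namespace SymOperad

variable (k : Type u) [Field k] (E : Type u)

/-- Multilinear extension of grafting a fixed tree. -/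
def graftLin {S : Type} [Finite S] {T : S → Type} (t : MTree E S) :
    MultilinearMap k (fun s => MTree E (T s) →₀ k) (MTree E (Σ s, T s) →₀ k) := by
  classical
  haveI := Fintype.ofFinite S
  exact (Finsupp.lmapDomain k k (fun u : ∀ s, MTree E (T s) => t.graft u)).compMultilinearMap
    ((PiTensorProduct.ofFinsuppEquiv' (R := k)
      (κ := fun s => MTree E (T s))).toLinearMap.compMultilinearMap (PiTensorProduct.tprod k))

theorem graftLin_single {S : Type} [Finite S] {T : S → Type} (t : MTree E S)
    (u : ∀ s, MTree E (T s)) :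
    graftLin k E t (fun s => Finsupp.single (u s) 1) = Finsupp.single (t.graft u) 1 := by
  classical
  simp [graftLin, Finsupp.mapDomain_single]

/-- Composition in the free operad. -/
def freeComp {S : Type} [Finite S] {T : S → Type} :
    (MTree E S →₀ k) →ₗ[k]
      MultilinearMap k (fun s => MTree E (T s) →₀ k) (MTree E (Σ s, T s) →₀ k) :=
  Finsupp.linearCombination k (fun t => graftLin k E t)

theorem freeComp_single {S : Type} [Finite S] {T : S → Type} (t : MTree E S)
    (u : ∀ s, MTree E (T s)) :
    freeComp k E (Finsupp.single t 1) (fun s => Finsupp.single (u s) 1) =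
      Finsupp.single (t.graft u) 1 := by
  simp [freeComp, graftLin_single]

theorem multilinear_ext {S : Type} [Finite S] {κ : S → Type u} {N : Type u} [AddCommGroup N]
    [Module k N] {f g : MultilinearMap k (fun s => κ s →₀ k) N}
    (h : ∀ u : ∀ s, κ s, f (fun s => Finsupp.single (u s) 1) =
      g (fun s => Finsupp.single (u s) 1)) : f = g := by
  refine Module.Basis.ext_multilinear (fun s => Finsupp.basisSingleOne) ?_
  intro u
  simpa using h u

/-- Composition with fixed inner factors, as a linear map in the outer one. -/
def freeCompLeft {S : Type} [Finite S] {T : S → Type} (q : ∀ s, MTree E (T s) →₀ k) :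
    (MTree E S →₀ k) →ₗ[k] (MTree E (Σ s, T s) →₀ k) where
  toFun p := freeComp k E p q
  map_add' _ _ := by simp
  map_smul' _ _ := by simp

theorem graft_map_left {S S' : Type} {T : S' → Type} (e : S ≃ S') (t : MTree E S)
    (u : ∀ s, MTree E (T s)) :
    (t.map e).graft u = (t.graft (fun s => u (e s))).map (Equiv.sigmaCongrLeft e) := by
  apply Subtype.ext
  simp only [MTree.graft, MTree.map, OpTree.map, OpTree.bind_bind, OpTree.bind]
  rfl

theorem graft_map_right {S : Type} {T T' : S → Type} (e : ∀ s, T s ≃ T' s) (t : MTree E S)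
    (u : ∀ s, MTree E (T s)) :
    t.graft (fun s => (u s).map (e s)) = (t.graft u).map (Equiv.sigmaCongrRight e) := by
  apply Subtype.ext
  simp only [MTree.graft, MTree.map, OpTree.map, OpTree.bind_bind, OpTree.bind]
  rfl

theorem one_graft {T : Unit → Type} (u : ∀ s, MTree E (T s)) :
    MTree.one.graft u = (u ()).map (Equiv.uniqueSigma T).symm := rfl

theorem graft_one {S : Type} (t : MTree E S) :
    t.graft (fun _ => MTree.one) = t.map (Equiv.sigmaUnique S (fun _ => Unit)).symm := rfl

theorem graft_assoc {S : Type} {T : S → Type} {U : ∀ s, T s → Type} (t : MTree E S)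
    (u : ∀ s, MTree E (T s)) (v : ∀ s x, MTree E (U s x)) :
    ((t.graft u).graft (fun x => v x.1 x.2)).map (Equiv.sigmaAssoc U) =
      t.graft (fun s => (u s).graft (v s)) := by
  apply Subtype.ext
  simp only [MTree.graft, MTree.map, OpTree.map, OpTree.bind_bind, OpTree.bind]
  rfl

/-- The free symmetric operad on a set `E` of binary operations without any symmetry: in
arity `S` it has the multilinear tree monomials as a basis. -/
def freeOperad : SymOperad.{u, u} k where
  obj S _ := MTree E S →₀ k
  map e := Finsupp.lmapDomain k k (MTree.map e)
  one := Finsupp.single MTree.one 1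
  comp := freeComp k E
  map_refl {S} _ p := by
    have h : MTree.map (E := E) (Equiv.refl S) = id := by
      funext t
      exact Subtype.ext (OpTree.bind_leaf t.1)
    rw [h, Finsupp.lmapDomain_id]
    rfl
  map_trans {S T U} _ _ _ e f p := by
    have h : MTree.map (E := E) (e.trans f) = MTree.map f ∘ MTree.map e := by
      funext t
      apply Subtype.ext
      simp only [MTree.map, OpTree.map, Function.comp, OpTree.bind_bind, OpTree.bind]
      rfl
    rw [h, Finsupp.lmapDomain_comp]
    rfl
  comp_map_left {S S'} _ _ T _ e p q := by
    induction p using Finsupp.induction_linear with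
    | zero => simp
    | add p p' h h' => simp only [map_add, add_apply, h, h']
    | single t a =>
      rw [← mul_one a, ← smul_eq_mul, ← Finsupp.smul_single]
      simp only [map_smul, smul_apply]
      congr 1
      rw [Finsupp.lmapDomain_apply, Finsupp.mapDomain_single]
      have := multilinear_ext k
        (f := freeComp k E (T := T) (Finsupp.single (t.map e) 1))
        (g := (Finsupp.lmapDomain k k (MTree.map (Equiv.sigmaCongrLeft e))).compMultilinearMap
          ((MultilinearMap.domDomCongrLinearEquiv' k k (fun s => MTree E (T s) →₀ k) _
            e.symm).symm (freeComp k E (Finsupp.single t 1)))) (fun u => by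
          change freeComp k E (Finsupp.single (t.map e) 1) (fun s => Finsupp.single (u s) 1) =
            Finsupp.lmapDomain k k (MTree.map (Equiv.sigmaCongrLeft e))
              (freeComp k E (Finsupp.single t 1) (fun s => Finsupp.single (u (e s)) 1))
          rw [freeComp_single, freeComp_single, Finsupp.lmapDomain_apply,
            Finsupp.mapDomain_single, graft_map_left])
      exact congrArg (fun f => f q) this
  comp_map_right {S} _ T T' _ _ e p q := by
    induction p using Finsupp.induction_linear with
    | zero => simp
    | add p p' h h' => simp only [map_add, add_apply, h, h']
    | single t a =>
      rw [← mul_one a, ← smul_eq_mul, ← Finsupp.smul_single]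
      simp only [map_smul, smul_apply]
      congr 1
      have := multilinear_ext k
        (f := (freeComp k E (Finsupp.single t 1)).compLinearMap
          (fun s => Finsupp.lmapDomain k k (MTree.map (e s))))
        (g := (Finsupp.lmapDomain k k (MTree.map (Equiv.sigmaCongrRight e))).compMultilinearMap
          (freeComp k E (Finsupp.single t 1))) (fun u => by
          simp only [MultilinearMap.compLinearMap_apply, LinearMap.compMultilinearMap_apply,
            Finsupp.lmapDomain_apply, Finsupp.mapDomain_single, freeComp_single,
            graft_map_right])
      exact congrArg (fun f => f q) this
  one_comp {T} _ q := by
    have := multilinear_ext k (f := freeComp k E (T := T) (Finsupp.single MTree.one 1))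
      (g := (Finsupp.lmapDomain k k (MTree.map (Equiv.uniqueSigma T).symm)).compMultilinearMap
        { toFun := fun q => q ()
          map_update_add' := by rintro _ q ⟨⟩ a b; simp
          map_update_smul' := by rintro _ q ⟨⟩ a b; simp }) (fun u => by
        rw [freeComp_single, one_graft]
        simp [Finsupp.mapDomain_single])
    exact congrArg (fun f => f q) this
  comp_one p := by
    induction p using Finsupp.induction_linear with
    | zero => simp
    | add p p' h h' => simp only [map_add, add_apply, h, h']
    | single t a =>
      rw [← mul_one a, ← smul_eq_mul, ← Finsupp.smul_single]
      simp only [map_smul, smul_apply]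
      rw [freeComp_single, graft_one, Finsupp.lmapDomain_apply, Finsupp.mapDomain_single]
  comp_assoc {S} _ T _ U _ p q r := by
    induction p using Finsupp.induction_linear with
    | zero => simp
    | add p p' h h' => simp only [map_add, add_apply, h, h']
    | single t a =>
      rw [← mul_one a, ← smul_eq_mul, ← Finsupp.smul_single]
      simp only [map_smul, smul_apply]
      congr 1
      have key : ∀ (u : ∀ s, MTree E (T s)),
          Finsupp.lmapDomain k k (MTree.map (Equiv.sigmaAssoc U))
            (freeComp k E (Finsupp.single (t.graft u) 1) (fun x => r x.1 x.2)) =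
          freeComp k E (Finsupp.single t 1)
            (fun s => freeComp k E (Finsupp.single (u s) 1) (r s)) := by
        intro u
        have := multilinear_ext k
          (f := (Finsupp.lmapDomain k k (MTree.map (Equiv.sigmaAssoc U))).compMultilinearMap
            (freeComp k E (T := fun x : Σ s, T s => U x.1 x.2)
              (Finsupp.single (t.graft u) 1)))
          (g := (freeComp k E (Finsupp.single t 1)).compMultilinearMap
            (fun s => freeComp k E (Finsupp.single (u s) 1))) (fun v => by
            change Finsupp.lmapDomain k k (MTree.map (Equiv.sigmaAssoc U))
              (freeComp k E (Finsupp.single (t.graft u) 1) (fun x => Finsupp.single (v x) 1)) =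
              freeComp k E (Finsupp.single t 1) (fun s =>
                freeComp k E (Finsupp.single (u s) 1) (fun x => Finsupp.single (v ⟨s, x⟩) 1))
            simp only [freeComp_single, Finsupp.lmapDomain_apply, Finsupp.mapDomain_single]
            rw [← graft_assoc])
        exact congrArg (fun f => f (fun x => r x.1 x.2)) this
      have := multilinear_ext k
        (f := (Finsupp.lmapDomain k k (MTree.map (Equiv.sigmaAssoc U)) ∘ₗ
          freeCompLeft k E (fun x : Σ s, T s => r x.1 x.2)).compMultilinearMap
            (freeComp k E (Finsupp.single t 1)))
        (g := (freeComp k E (Finsupp.single t 1)).compLinearMap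
          (fun s => freeCompLeft k E (r s))) (fun u => by
          simp only [LinearMap.compMultilinearMap_apply, freeComp_single,
            MultilinearMap.compLinearMap_apply]
          exact key u)
      exact congrArg (fun f => f q) this

end SymOperad

/-! ### Binary quadratic operads and their Koszul duals

For an `S₂`-module `E` of binary operations (the transposition `swap` replaces the operation
`x e y` by `y e x`), the arity-three part of the free operad is `Fin 3 → E ⊗ E`: in the component
`j`, the tensor `e ⊗ f` stands for the monomial `(x_{j+1} f x_{j+2}) e x_j` with indices
modulo `3`. -/

section Quadratic

variable {k : Type u} [Field k]

/-- Relabelling of variables by `σ` on the arity-three part of the free operad. An even `σ`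
preserves the cyclic order of the inner variables, an odd one reverses it. -/
def cubicAct {E : Type u} [AddCommGroup E] [Module k E] (swap : E →ₗ[k] E)
    (σ : Equiv.Perm (Fin 3)) : (Fin 3 → E ⊗[k] E) →ₗ[k] (Fin 3 → E ⊗[k] E) :=
  LinearMap.pi fun i =>
    (if Equiv.Perm.sign σ = 1 then LinearMap.id else LinearMap.lTensor E swap) ∘ₗ
      LinearMap.proj (σ⁻¹ i)

/-- Binary quadratic data: a finite-dimensional `S₂`-module of generating operations and an
`S₃`-submodule of quadratic relations. -/
structure BinQuadData (k : Type u) [Field k] where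
  E : Type u
  [grp : AddCommGroup E]
  [mod : Module k E]
  [fin : Module.Finite k E]
  swap : E →ₗ[k] E
  swap_swap : ∀ e, swap (swap e) = e
  R : Submodule k (Fin 3 → E ⊗[k] E)
  R_stable : ∀ (σ : Equiv.Perm (Fin 3)), ∀ r ∈ R, cubicAct swap σ r ∈ R

attribute [instance] BinQuadData.grp BinQuadData.mod BinQuadData.fin

namespace BinQuadData

/-- The element of `Fin 3 → E ⊗ E` represented by a formal combination of cubic monomials. -/
def toTensor (D : BinQuadData.{u} k) : (Fin 3 × D.E × D.E →₀ k) →ₗ[k] (Fin 3 → D.E ⊗[k] D.E) :=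
  Finsupp.linearCombination k fun x => Pi.single x.1 (x.2.1 ⊗ₜ[k] x.2.2)

/-- The element of the free operad on the set `E` represented by the same combination. -/
def toFree (D : BinQuadData.{u} k) :
    (Fin 3 × D.E × D.E →₀ k) →ₗ[k] (SymOperad.freeOperad k D.E).obj (Fin 3) :=
  Finsupp.lmapDomain k k fun x => MTree.cubic x.1 x.2.1 x.2.2

/-- The operation `e` in the free operad on the set `E`. -/
def freeGen (D : BinQuadData.{u} k) (e : D.E) : (SymOperad.freeOperad k D.E).obj (Fin 2) :=
  Finsupp.single (MTree.corolla e) 1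

/-- The relations imposed on the free operad on the set `E`: linearity in `E`, the `S₂`-action
of `E`, and the quadratic relations `R`. -/
inductive Rel (D : BinQuadData.{u} k) :
    (S : Type) → [Finite S] → (SymOperad.freeOperad k D.E).obj S → Prop
  | add (e f : D.E) : Rel D (Fin 2) (D.freeGen (e + f) - D.freeGen e - D.freeGen f)
  | smul (c : k) (e : D.E) : Rel D (Fin 2) (D.freeGen (c • e) - c • D.freeGen e)
  | swap (e : D.E) : Rel D (Fin 2) (D.freeGen (D.swap e) -
      (SymOperad.freeOperad k D.E).map (Equiv.swap (0 : Fin 2) 1) (D.freeGen e))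
  | quad (l : Fin 3 × D.E × D.E →₀ k) : D.toTensor l ∈ D.R → Rel D (Fin 3) (D.toFree l)

/-- The ideal generated by the relations. -/
def ideal (D : BinQuadData.{u} k) : (SymOperad.freeOperad k D.E).Ideal :=
  SymOperad.idealSpan _ fun S _ => {p | Rel D S p}

/-- The quadratic operad `P(E, R)`, the quotient of the free operad on the `S₂`-module `E` by the
ideal generated by `R`. -/
def operad (D : BinQuadData.{u} k) : SymOperad.{u, u} k := D.ideal.quotient

/-- The generating operation `e` of `P(E, R)`. -/
def gen (D : BinQuadData.{u} k) (e : D.E) : D.operad.obj (Fin 2) :=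
  Submodule.Quotient.mk (p := D.ideal.carrier (Fin 2)) (D.freeGen e)

/-- The canonical pairing between the arity-three parts of the free operads on `E^∨` and on `E`. -/
def pairing {E : Type u} [AddCommGroup E] [Module k E] :
    (Fin 3 → Module.Dual k E ⊗[k] Module.Dual k E) →ₗ[k] (Fin 3 → E ⊗[k] E) →ₗ[k] k :=
  ∑ i : Fin 3, (TensorProduct.dualDistrib k E E).compl₁₂ (LinearMap.proj i) (LinearMap.proj i)

theorem pairing_apply {E : Type u} [AddCommGroup E] [Module k E]
    (y : Fin 3 → Module.Dual k E ⊗[k] Module.Dual k E) (r : Fin 3 → E ⊗[k] E) :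
    pairing y r = ∑ i : Fin 3, TensorProduct.dualDistrib k E E (y i) (r i) := by
  simp [pairing]

/-- With the sign-twisted dual action, the pairing is invariant up to the signature. -/
theorem pairing_act {E : Type u} [AddCommGroup E] [Module k E] (swap : E →ₗ[k] E)
    (hs : ∀ e, swap (swap e) = e) (σ : Equiv.Perm (Fin 3))
    (y : Fin 3 → Module.Dual k E ⊗[k] Module.Dual k E) (r : Fin 3 → E ⊗[k] E) :
    pairing (cubicAct (-swap.dualMap) σ y) (cubicAct swap σ r) =
      ((Equiv.Perm.sign σ : ℤ) : k) * pairing y r := by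
  have key : ∀ (a : Module.Dual k E ⊗[k] Module.Dual k E) (b : E ⊗[k] E),
      TensorProduct.dualDistrib k E E (LinearMap.lTensor _ (-swap.dualMap) a)
        (LinearMap.lTensor E swap b) = - TensorProduct.dualDistrib k E E a b := by
    intro a b
    induction a with
    | zero => simp
    | add a a' h h' => simp only [map_add, LinearMap.add_apply, h, h']; ring
    | tmul f g =>
      induction b with
      | zero => simp
      | add b b' h h' => simp only [map_add, h, h']; ring
      | tmul e e' =>
        rw [LinearMap.lTensor_tmul, LinearMap.lTensor_tmul, TensorProduct.dualDistrib_apply,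
          TensorProduct.dualDistrib_apply, LinearMap.neg_apply, LinearMap.neg_apply,
          LinearMap.dualMap_apply, hs, mul_neg]
  rw [pairing_apply, pairing_apply, Finset.mul_sum]
  rw [← Equiv.sum_comp σ⁻¹ fun i => ((Equiv.Perm.sign σ : ℤ) : k) *
    TensorProduct.dualDistrib k E E (y i) (r i)]
  refine Finset.sum_congr rfl fun i _ => ?_
  rcases Int.units_eq_one_or (Equiv.Perm.sign σ) with h | h
  · simp [cubicAct, h]
  · have h1 : Equiv.Perm.sign σ ≠ 1 := by rw [h]; decide
    simp only [cubicAct, if_neg h1, LinearMap.pi_apply, LinearMap.comp_apply,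
      LinearMap.proj_apply, key]
    simp [h]

/-- The orthogonal complement of a space of quadratic relations. -/
def orth {E : Type u} [AddCommGroup E] [Module k E] (R : Submodule k (Fin 3 → E ⊗[k] E)) :
    Submodule k (Fin 3 → Module.Dual k E ⊗[k] Module.Dual k E) where
  carrier := {y | ∀ r ∈ R, pairing y r = 0}
  add_mem' ha hb r hr := by rw [map_add, LinearMap.add_apply, ha r hr, hb r hr, add_zero]
  zero_mem' r _ := by simp
  smul_mem' c y hy r hr := by rw [map_smul, LinearMap.smul_apply, hy r hr, smul_zero]

theorem cubicAct_mul {E : Type u} [AddCommGroup E] [Module k E] (swap : E →ₗ[k] E)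
    (hs : ∀ e, swap (swap e) = e) (σ τ : Equiv.Perm (Fin 3)) (r : Fin 3 → E ⊗[k] E) :
    cubicAct swap (σ * τ) r = cubicAct swap σ (cubicAct swap τ r) := by
  have hss : ∀ x : E ⊗[k] E, LinearMap.lTensor E swap (LinearMap.lTensor E swap x) = x := by
    intro x
    have h : swap ∘ₗ swap = LinearMap.id := LinearMap.ext hs
    rw [← LinearMap.lTensor_comp_apply, h, LinearMap.lTensor_id_apply]
  funext i
  rcases Int.units_eq_one_or (Equiv.Perm.sign σ) with h | h <;>
    rcases Int.units_eq_one_or (Equiv.Perm.sign τ) with h' | h' <;>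
    simp [cubicAct, h, h', hss, Equiv.Perm.mul_apply]

/-- The data `(E^∨, R^⊥)` of the Koszul dual operad: `E^∨` is the dual of `E` with the dual
`S₂`-action twisted by the signature, and `R^⊥` is the orthogonal complement of `R`. -/
def koszulDual (D : BinQuadData.{u} k) : BinQuadData.{u} k where
  E := Module.Dual k D.E
  swap := -D.swap.dualMap
  swap_swap e := by ext x; simp [D.swap_swap]
  R := orth D.R
  R_stable σ y hy r hr := by
    have h := cubicAct_mul D.swap D.swap_swap σ σ⁻¹ r
    have h1 : cubicAct D.swap (σ * σ⁻¹) r = r := by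
      funext i
      simp [cubicAct]
    rw [h1] at h
    rw [h, pairing_act D.swap D.swap_swap, hy _ (D.R_stable _ r hr), mul_zero]

/-! #### Operads presented by operations without symmetry and multilinear identities -/

/-- The free `S₂`-module on a set `Ω` of operations: `(a, false)` is the operation `x a y` and
`(a, true)` is the opposite operation `y a x`. -/
abbrev RegE (k : Type u) [Field k] (Ω : Type) : Type u := Ω × Bool →₀ k

def regSwap (k : Type u) [Field k] (Ω : Type) : RegE k Ω →ₗ[k] RegE k Ω :=
  Finsupp.lmapDomain k k (Prod.map id not)

theorem regSwap_regSwap (Ω : Type) (e : RegE k Ω) : regSwap k Ω (regSwap k Ω e) = e := by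
  have h : (Prod.map id not : Ω × Bool → Ω × Bool) ∘ Prod.map id not = id := by
    funext x
    rcases x with ⟨a, b⟩
    simp
  have := Finsupp.lmapDomain_comp (M := k) k (Prod.map id not : Ω × Bool → Ω × Bool)
    (Prod.map id not)
  rw [h, Finsupp.lmapDomain_id] at this
  exact (LinearMap.congr_fun this e).symm

/-- The operation `a`. -/
def op (k : Type u) [Field k] {Ω : Type} (a : Ω) : RegE k Ω := Finsupp.single (a, false) 1

/-- The monomial `(x_{σ 0} a x_{σ 1}) b x_{σ 2}`. -/
def left (k : Type u) [Field k] {Ω : Type} (σ : Equiv.Perm (Fin 3)) (a b : Ω) :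
    Fin 3 → RegE k Ω ⊗[k] RegE k Ω :=
  cubicAct (regSwap k Ω) σ (Pi.single 2 (op k b ⊗ₜ[k] op k a))

/-- The monomial `x_{σ 0} a (x_{σ 1} b x_{σ 2})`. -/
def right (k : Type u) [Field k] {Ω : Type} (σ : Equiv.Perm (Fin 3)) (a b : Ω) :
    Fin 3 → RegE k Ω ⊗[k] RegE k Ω :=
  cubicAct (regSwap k Ω) σ (Pi.single 0 (regSwap k Ω (op k a) ⊗ₜ[k] op k b))

/-- The quadratic data with generating operations `Ω` (without symmetry) and with the given
multilinear identities in `x₀, x₁, x₂`, closed under all relabellings of the variables. -/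
def ofIdentities (Ω : Type) [Finite Ω] (A : Set (Fin 3 → RegE k Ω ⊗[k] RegE k Ω)) :
    BinQuadData.{u} k where
  E := RegE k Ω
  swap := regSwap k Ω
  swap_swap := regSwap_regSwap Ω
  R := Submodule.span k {x | ∃ σ : Equiv.Perm (Fin 3), ∃ r ∈ A, x = cubicAct (regSwap k Ω) σ r}
  R_stable σ r hr := by
    induction hr using Submodule.span_induction with
    | mem x hx =>
      obtain ⟨τ, r, hr, rfl⟩ := hx
      rw [← cubicAct_mul _ (regSwap_regSwap Ω)]
      exact Submodule.subset_span ⟨σ * τ, r, hr, rfl⟩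
    | zero => rw [map_zero]; exact zero_mem _
    | add x y _ _ hx hy => rw [map_add]; exact add_mem hx hy
    | smul c x _ hx => rw [map_smul]; exact Submodule.smul_mem _ c hx

end BinQuadData

end Quadratic

/-! ### Algebras over an operad generated by two binary operations -/

section Algebras

variable {k : Type u} [Field k]

/-- The bilinear operation on `V` given by an arity-two element of the endomorphism operad. -/
def SymOperad.bilin {V : Type v} [AddCommGroup V] [Module k V]
    (f : (SymOperad.endOperad k V).obj (Fin 2)) : V →ₗ[k] V →ₗ[k] V :=
  have f : MultilinearMap k (fun _ : Fin 2 => V) V := f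
  LinearMap.mk₂ k (fun x y => f ![x, y])
    (fun x x' y => f.cons_add ![y] x x')
    (fun c x y => f.cons_smul ![y] c x)
    (fun x y y' => by
      have h : ∀ z : V, Function.update ![x, 0] 1 z = ![x, z] := fun z => by
        funext i; fin_cases i <;> simp
      have := f.map_update_add ![x, 0] 1 y y'
      rwa [h, h, h] at this)
    (fun c x y => by
      have h : ∀ z : V, Function.update ![x, 0] 1 z = ![x, z] := fun z => by
        funext i; fin_cases i <;> simp
      have := f.map_update_smul ![x, 0] 1 c y
      rwa [h, h] at this)

/-- An algebra over `P` on `V` is a morphism from `P` to the endomorphism operad of `V`. This says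
that `P`-algebras on `V` are the same, through the two operations `g` and `h` of `P`, as pairs of
bilinear operations on `V` with the property `A`. -/
def SymOperad.AlgebrasAre (P : SymOperad.{u, w} k) (g h : P.obj (Fin 2)) (V : Type v)
    [AddCommGroup V] [Module k V] (A : (V →ₗ[k] V →ₗ[k] V) → (V →ₗ[k] V →ₗ[k] V) → Prop) : Prop :=
  let ops : SymOperad.Hom P (SymOperad.endOperad k V) → (V →ₗ[k] V →ₗ[k] V) × (V →ₗ[k] V →ₗ[k] V) :=
    fun φ => (SymOperad.bilin (φ.app (Fin 2) g), SymOperad.bilin (φ.app (Fin 2) h))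
  Function.Injective ops ∧ Set.range ops = {p | A p.1 p.2}

end Algebras

/-! ### Transposed `δ`-Leibniz–Poisson algebras and the dual identities -/

section TLP

variable {k : Type u} [Field k]

/-- `V` with the product `m x y = x y` and the bracket `b x y = {x, y}` is a (noncommutative)
transposed `δ`-Leibniz–Poisson algebra. -/
structure IsTLP (δ : k) {V : Type v} [AddCommGroup V] [Module k V] (m b : V →ₗ[k] V →ₗ[k] V) :
    Prop where
  assoc : ∀ x y z, m (m x y) z = m x (m y z)
  leibniz : ∀ x y z, b (b x y) z = b x (b y z) - b y (b x z)
  compat : ∀ x y z, δ • m x (b y z) = b (m x y) z + b y (m x z)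

/-- The identities of the Koszul dual algebras, for `m x y = x y` and `s x y = x ⋆ y`. -/
structure IsDualTLP (δ : k) {V : Type v} [AddCommGroup V] [Module k V] (m s : V →ₗ[k] V →ₗ[k] V) :
    Prop where
  assoc : ∀ x y z, m (m x y) z = m x (m y z)
  zinbiel : ∀ x y z, s x (s y z) = s (s x y) z + s (s y x) z
  mixed_of_ne : δ ≠ 0 → ∀ x y z, m x (s y z) = δ • s (m x y) z ∧
    m x (s y z) = δ • s y (m x z) ∧ m (s x y) z = 0
  mixed_of_eq : δ = 0 → ∀ x y z, m (s x y) z = 0 ∧ m x (s y z) = 0 ∧ s y (m x z) = s (m x y) z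

inductive TLPOp
  | mul | bracket

inductive DualTLPOp
  | mul | star

instance : Finite TLPOp :=
  Finite.of_injective (fun a => match a with | .mul => true | .bracket => false) (by
    rintro ⟨⟩ ⟨⟩ <;> simp)

instance : Finite DualTLPOp :=
  Finite.of_injective (fun a => match a with | .mul => true | .star => false) (by
    rintro ⟨⟩ ⟨⟩ <;> simp)

open BinQuadData in
/-- The operad of transposed `δ`-Leibniz–Poisson algebras, as binary quadratic data. -/
def tlpData (δ : k) : BinQuadData.{u} k :=
  ofIdentities TLPOp
    { left k 1 .mul .mul - right k 1 .mul .mul,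
      left k 1 .bracket .bracket -
        (right k 1 .bracket .bracket - right k (Equiv.swap 0 1) .bracket .bracket),
      δ • right k 1 .mul .bracket -
        (left k 1 .mul .bracket + right k (Equiv.swap 0 1) .bracket .mul) }

open BinQuadData in
/-- The operad presented by an associative product and a Zinbiel product with the mixed
relations. -/
def dualTLPData (δ : k) : BinQuadData.{u} k :=
  ofIdentities DualTLPOp
    ({ left k 1 .mul .mul - right k 1 .mul .mul,
       right k 1 .star .star -
         (left k 1 .star .star + left k (Equiv.swap 0 1) .star .star) } ∪
     {r | δ ≠ 0 ∧ (r = right k 1 .mul .star - δ • left k 1 .mul .star ∨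
       r = right k 1 .mul .star - δ • right k (Equiv.swap 0 1) .star .mul ∨
       r = left k 1 .star .mul)} ∪
     {r | δ = 0 ∧ (r = left k 1 .star .mul ∨ r = right k 1 .mul .star ∨
       r = right k (Equiv.swap 0 1) .star .mul - left k 1 .mul .star)})

/-- The product and the bracket, as generating operations. -/
def tlpMul (δ : k) : (tlpData δ).E := BinQuadData.op k TLPOp.mul
def tlpBracket (δ : k) : (tlpData δ).E := BinQuadData.op k TLPOp.bracket

/-- The generators of the Koszul dual: the elements dual to `x₀ x₁` and to `{x₀, x₁}` in the
basis `x₀ x₁, x₁ x₀, {x₀, x₁}, {x₁, x₀}`. -/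
def dualMul (δ : k) : (tlpData δ).koszulDual.E :=
  (Finsupp.lapply (TLPOp.mul, false) : BinQuadData.RegE k TLPOp →ₗ[k] k)
def dualStar (δ : k) : (tlpData δ).koszulDual.E :=
  (Finsupp.lapply (TLPOp.bracket, false) : BinQuadData.RegE k TLPOp →ₗ[k] k)

end TLP

/-! ### Morphisms of operads -/

namespace SymOperad

variable {k : Type u} [Field k]

namespace Hom

universe w'

/-! Two independent facts are combined: what an algebra over a presented quadratic operad is, and
what the orthogonal complement of the given relations is.

Algebras. A morphism out of the free operad is determined by the images of the corollas
(`freeOperad_hom_ext`), and any family of bilinear operations extends to one by evaluating trees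
(`freeEval`). Passing to the quotient, a `P(E, R)`-algebra on `V` is an equivariant linear map from
`E` to bilinear operations whose cubic evaluation kills `R` (`genLin_injective`,
`evalTensor_genLin`, `exists_genLin_eq`). When `E` is free on a set of operations without symmetry,
this says that those operations satisfy the chosen identities for all values of the variables
(`algebrasAre_ofIdentities`).

Orthogonal complement. The arity-three part has as a basis the monomials `(x_{σ 0} a x_{σ 1}) b x_{σ
2}` and `x_{σ 0} a (x_{σ 1} b x_{σ 2})`, with `σ` in `S₃`. After the opposite dual generators are
given a minus sign, the pairing is diagonal in these bases, with entry `sign σ` on left monomials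
and `-sign σ` on right ones. The relations of `R` are relabellings of three identities, and each
relation has exactly one left monomial, of shape `(xy)z`, `{{x,y},z}` or `{xy,z}`. Dually, the
proposed identities rewrite every monomial as a combination of the left monomials `(xy)z`,
`(x⋆y)⋆z`, `(xy)⋆z`. The rewriting is an explicit operator `F`, whose coefficients are the pairings
with the relations of `R`. So `F` vanishes on an element `y` of the complement, while `y - F y`
always lies in the span of the dual identities; hence `y` does too (`mem_of_orth_tlpIdentities`). No
dimension count is needed. The reverse inclusion is a direct check (`dualTLPIdentities_orth`).

The dual basis therefore identifies the presented quadratic data with `(E^∨, R^⊥)`. Isomorphic data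
give isomorphic operads (`exists_isIso`), and algebras are transported along the isomorphism
(`AlgebrasAre.of_isIso`). -/

theorem ext_app {P : SymOperad.{u, v} k} {Q : SymOperad.{u, w} k} {f g : Hom P Q}
    (h : ∀ (S : Type) [Finite S] (p : P.obj S), f.app S p = g.app S p) : f = g := by
  cases f
  cases g
  congr
  funext S _
  exact LinearMap.ext (h S)

/-- Composition of morphisms of operads. -/
def trans {P : SymOperad.{u, v} k} {Q : SymOperad.{u, w} k} {R : SymOperad.{u, w'} k}
    (f : Hom P Q) (g : Hom Q R) : Hom P R where
  app S _ := g.app S ∘ₗ f.app S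
  app_map e p := by simp [f.app_map, g.app_map]
  app_one := by simp [f.app_one, g.app_one]
  app_comp p q := by simp [f.app_comp, g.app_comp]

/-- The inverse of an isomorphism of operads. -/
def symm {P : SymOperad.{u, v} k} {Q : SymOperad.{u, w} k} (f : Hom P Q) (hf : f.IsIso) :
    Hom Q P where
  app S _ := (LinearEquiv.ofBijective (f.app S) (hf S)).symm.toLinearMap
  app_map {S T} _ _ e p := by
    apply (hf T).1
    rw [f.app_map]
    have h1 := (LinearEquiv.ofBijective (f.app S) (hf S)).apply_symm_apply p
    have h2 := (LinearEquiv.ofBijective (f.app T) (hf T)).apply_symm_apply (Q.map e p)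
    exact h2.trans (congrArg _ h1.symm)
  app_one := by
    apply (hf Unit).1
    rw [f.app_one]
    exact (LinearEquiv.ofBijective (f.app Unit) (hf Unit)).apply_symm_apply Q.one
  app_comp {S} _ {T} _ p q := by
    apply (hf _).1
    rw [f.app_comp]
    have h1 := (LinearEquiv.ofBijective (f.app S) (hf S)).apply_symm_apply p
    have h2 : (fun s => f.app (T s) ((LinearEquiv.ofBijective (f.app (T s)) (hf (T s))).symm
        (q s))) = q :=
      funext fun s => (LinearEquiv.ofBijective (f.app (T s)) (hf (T s))).apply_symm_apply (q s)
    have h3 := (LinearEquiv.ofBijective (f.app _) (hf _)).apply_symm_apply (Q.comp p q)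
    refine h3.trans ?_
    exact (congr (congrArg (fun a => ⇑(Q.comp a)) h1) h2).symm

theorem app_symm_app {P : SymOperad.{u, v} k} {Q : SymOperad.{u, w} k} (f : Hom P Q)
    (hf : f.IsIso) {S : Type} [Finite S] (p : P.obj S) : (f.symm hf).app S (f.app S p) = p :=
  (LinearEquiv.ofBijective (f.app S) (hf S)).symm_apply_apply p

/-- The kernel of a morphism of operads. -/
def ker {P : SymOperad.{u, v} k} {Q : SymOperad.{u, w} k} (f : Hom P Q) : P.Ideal where
  carrier S _ := LinearMap.ker (f.app S)
  map_mem e p hp := by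
    rw [LinearMap.mem_ker] at hp ⊢
    rw [f.app_map, hp, map_zero]
  comp_left_mem q hp := by
    rw [LinearMap.mem_ker] at hp ⊢
    rw [f.app_comp, hp, map_zero]
    rfl
  comp_right_mem p q s hq := by
    rw [LinearMap.mem_ker] at hq ⊢
    rw [f.app_comp]
    exact MultilinearMap.map_coord_zero _ s hq

end Hom

theorem idealSpan_le {P : SymOperad.{u, v} k} {A : ∀ (S : Type) [Finite S], Set (P.obj S)}
    (J : P.Ideal) (h : ∀ (S : Type) [Finite S], A S ⊆ J.carrier S) (S : Type) [Finite S] :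
    (P.idealSpan A).carrier S ≤ J.carrier S :=
  iInf₂_le J h

theorem subset_idealSpan {P : SymOperad.{u, v} k} {A : ∀ (S : Type) [Finite S], Set (P.obj S)}
    {S : Type} [Finite S] {p : P.obj S} (hp : p ∈ A S) : p ∈ (P.idealSpan A).carrier S := by
  simp only [idealSpan, Submodule.mem_iInf]
  exact fun J hJ => hJ S hp

namespace Ideal

variable {P : SymOperad.{u, v} k} (I : P.Ideal)

/-- The projection onto the quotient by an ideal. -/
def mkHom : Hom P I.quotient where
  app S _ := (I.carrier S).mkQ
  app_map _ _ := rfl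
  app_one := rfl
  app_comp p q := (I.quotComp_mk p q).symm

/-- The morphism induced on the quotient by an ideal. -/
def lift {Q : SymOperad.{u, w} k} (f : Hom P Q)
    (h : ∀ (S : Type) [Finite S], I.carrier S ≤ LinearMap.ker (f.app S)) :
    Hom I.quotient Q where
  app S _ := (I.carrier S).liftQ (f.app S) (h S)
  app_map e p := by
    obtain ⟨p, rfl⟩ := Submodule.Quotient.mk_surjective _ p
    exact f.app_map e p
  app_one := f.app_one
  app_comp p q := by
    obtain ⟨p, rfl⟩ := Submodule.Quotient.mk_surjective _ p
    obtain ⟨q, rfl⟩ := I.exists_mk q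
    change (I.carrier _).liftQ (f.app _) (h _) (I.quotComp _ _) = _
    rw [quotComp_mk]
    exact f.app_comp p q

end Ideal

/-- Algebras can be transported along an isomorphism of operads. -/
theorem AlgebrasAre.of_isIso {P : SymOperad.{u, v} k} {Q : SymOperad.{u, w} k} {f : Hom P Q}
    (hf : f.IsIso) {g h : P.obj (Fin 2)} {V : Type*} [AddCommGroup V] [Module k V]
    {A : (V →ₗ[k] V →ₗ[k] V) → (V →ₗ[k] V →ₗ[k] V) → Prop} (H : P.AlgebrasAre g h V A) :
    Q.AlgebrasAre (f.app (Fin 2) g) (f.app (Fin 2) h) V A := by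
  obtain ⟨h1, h2⟩ := H
  refine ⟨fun φ ψ hφψ => ?_, ?_⟩
  · have : f.trans φ = f.trans ψ := h1 hφψ
    refine Hom.ext_app fun S _ p => ?_
    obtain ⟨p, rfl⟩ := (hf S).2 p
    exact congrArg (fun χ => Hom.app χ S p) this
  · rw [← h2]
    ext p
    constructor
    · rintro ⟨φ, rfl⟩
      exact ⟨f.trans φ, rfl⟩
    · rintro ⟨φ, rfl⟩
      refine ⟨(f.symm hf).trans φ, ?_⟩
      simp only [Hom.trans, LinearMap.comp_apply, Hom.app_symm_app]

end SymOperad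

/-! ### Morphisms out of the free operad -/

namespace OpTree

variable {E : Type u} {X Y : Type}

/-- The value of a tree monomial, when each `e : E` acts as the binary operation `b e`. -/
def eval {V : Type v} (b : E → V → V → V) : OpTree E X → (X → V) → V
  | leaf x, v => v x
  | node e t t', v => b e (t.eval b v) (t'.eval b v)

section eval

variable {V : Type v} (b : E → V → V → V)

theorem eval_bind (t : OpTree E X) (f : X → OpTree E Y) (v : Y → V) :
    (t.bind f).eval b v = t.eval b fun x => (f x).eval b v := by
  induction t with
  | leaf x => rfl
  | node e t t' h h' => simp [bind, eval, h, h']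

theorem eval_map (f : X → Y) (t : OpTree E X) (v : Y → V) :
    (t.map f).eval b v = t.eval b fun x => v (f x) :=
  eval_bind b t _ v

theorem eval_congr {t : OpTree E X} {v v' : X → V} (h : ∀ x ∈ t.leaves, v x = v' x) :
    t.eval b v = t.eval b v' := by
  induction t with
  | leaf x => exact h x (by simp [leaves])
  | node e t t' ih ih' =>
    simp only [leaves, List.mem_append] at h
    rw [eval, eval, ih fun x hx => h x (Or.inl hx), ih' fun x hx => h x (Or.inr hx)]

theorem eval_update_of_notMem [DecidableEq X] {t : OpTree E X} {s : X} (hs : s ∉ t.leaves)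
    (v : X → V) (a : V) : t.eval b (Function.update v s a) = t.eval b v :=
  eval_congr b fun x hx => Function.update_of_ne (fun h : x = s => hs (h ▸ hx)) a v

end eval

variable {k : Type u} [Field k] {V : Type v} [AddCommGroup V] [Module k V]
  (b : E → V →ₗ[k] V →ₗ[k] V)

/-- Since labels do not repeat, the label `s` lies in exactly one of the two subtrees at a vertex.
The other subtree does not see the update, so induction composes linear maps. A single linear map
yields both additivity and homogeneity in the variable `s`. -/
theorem exists_linear_eval_update [DecidableEq X] {t : OpTree E X} (ht : t.leaves.Nodup) {s : X}
    (hs : s ∈ t.leaves) (v : X → V) :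
    ∃ l : V →ₗ[k] V, ∀ a, t.eval (fun e x y => b e x y) (Function.update v s a) = l a := by
  induction t with
  | leaf x =>
    obtain rfl : s = x := by simpa [leaves] using hs
    exact ⟨LinearMap.id, fun a => by simp [eval]⟩
  | node e t t' ih ih' =>
    simp only [leaves, List.nodup_append, List.mem_append] at ht hs
    obtain ⟨h1, h2, h3⟩ := ht
    rcases hs with hs | hs
    · obtain ⟨l, hl⟩ := ih h1 hs
      refine ⟨(b e).flip (t'.eval (fun e x y => b e x y) v) ∘ₗ l, fun a => ?_⟩
      rw [eval, hl, eval_update_of_notMem _ fun h => h3 s hs s h rfl]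
      rfl
    · obtain ⟨l, hl⟩ := ih' h2 hs
      refine ⟨b e (t.eval (fun e x y => b e x y) v) ∘ₗ l, fun a => ?_⟩
      rw [eval, hl, eval_update_of_notMem _ fun h => h3 s h s hs rfl]
      rfl

/-- Cuts the label type of a subtree down to the labels it uses, so that the subtree can serve as an
inner factor of a grafting. -/
theorem exists_map_val (t : OpTree E X) (p : X → Prop) (h : ∀ x ∈ t.leaves, p x) :
    ∃ t' : OpTree E {x // p x}, t'.map Subtype.val = t := by
  induction t with
  | leaf x => exact ⟨leaf ⟨x, h x (by simp [leaves])⟩, rfl⟩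
  | node e t t' ih ih' =>
    simp only [leaves, List.mem_append] at h
    obtain ⟨u, rfl⟩ := ih fun x hx => h x (Or.inl hx)
    obtain ⟨u', rfl⟩ := ih' fun x hx => h x (Or.inr hx)
    exact ⟨node e u u', rfl⟩

end OpTree

/-- The multilinear operation given by a multilinear tree monomial. -/
def MTree.evalMultilinear {E : Type u} {k : Type u} [Field k] {V : Type v} [AddCommGroup V]
    [Module k V] (b : E → V →ₗ[k] V →ₗ[k] V) {S : Type} (t : MTree E S) :
    MultilinearMap k (fun _ : S => V) V where
  toFun v := t.1.eval (fun e x y => b e x y) v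
  map_update_add' v s x y := by
    obtain ⟨l, hl⟩ := t.1.exists_linear_eval_update b t.2.1 (t.2.2 s) v
    rw [hl, hl, hl, map_add]
  map_update_smul' v s c x := by
    obtain ⟨l, hl⟩ := t.1.exists_linear_eval_update b t.2.1 (t.2.2 s) v
    rw [hl, hl, map_smul]

/-- A multilinear tree with a vertex at the root is a relabelled grafting on a corolla. -/
theorem MTree.exists_eq_map_graft {E : Type u} {S : Type} [Finite S] (t : MTree E S) {e : E}
    {t₁ t₂ : OpTree E S} (ht : t.1 = .node e t₁ t₂) :
    ∃ (T : Fin 2 → Type) (_ : ∀ i, Finite (T i)) (u : ∀ i, MTree E (T i))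
      (f : (Σ i, T i) ≃ S), t = ((corolla e).graft u).map f ∧
        ∀ i, (u i).1.leaves.length < t.1.leaves.length := by
  obtain ⟨h1, h2⟩ := t.2
  rw [ht] at h1 h2
  simp only [OpTree.leaves, List.nodup_append, List.mem_append] at h1 h2
  -- The arities of the two inner factors are the leaf sets of the two subtrees at the root.
  let q : Fin 2 → OpTree E S := ![t₁, t₂]
  let T : Fin 2 → Type := fun i => {s // s ∈ (q i).leaves}
  have hq : ∀ i, ∃ u : MTree E (T i), u.1.map Subtype.val = q i := by
    intro i
    obtain ⟨u, hu⟩ := (q i).exists_map_val (fun s => s ∈ (q i).leaves) fun _ h => h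
    have hl : u.leaves.map Subtype.val = (q i).leaves := by rw [← OpTree.leaves_map, hu]
    have hn : (q i).leaves.Nodup := by fin_cases i <;> simp [q, h1]
    rw [← hl] at hn
    refine ⟨⟨u, List.Nodup.of_map _ hn, fun s => ?_⟩, hu⟩
    have hs : s.1 ∈ u.leaves.map Subtype.val := by rw [hl]; exact s.2
    obtain ⟨x, hx, hxs⟩ := List.mem_map.1 hs
    obtain rfl : x = s := Subtype.ext hxs
    exact hx
  choose u hu using hq
  -- Multilinearity of `t` says that the two leaf sets partition `S`: they are disjoint because no
  -- label repeats, and they cover because every label occurs.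
  have hbij : Function.Bijective fun x : Σ i, T i => x.2.1 := by
    constructor
    · rintro ⟨i, x, hx⟩ ⟨j, y, hy⟩ (rfl : x = y)
      have hij : i = j := by
        fin_cases i <;> fin_cases j <;> simp [q] at hx hy ⊢
        · exact h1.2.2 _ hx _ hy rfl
        · exact h1.2.2 _ hy _ hx rfl
      subst hij
      rfl
    · intro s
      rcases h2 s with h | h
      · exact ⟨⟨0, s, h⟩, rfl⟩
      · exact ⟨⟨1, s, h⟩, rfl⟩
  have hlen : ∀ i, (u i).1.leaves.length = (q i).leaves.length := fun i => by
    rw [← hu, OpTree.leaves_map, List.length_map]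
  -- No tree is empty, so each subtree has strictly fewer leaves than the whole.
  have hpos : ∀ t : OpTree E S, 0 < t.leaves.length := fun t => by
    induction t with
    | leaf x => simp [OpTree.leaves]
    | node e t t' h h' => simp [OpTree.leaves, h]
  refine ⟨T, fun i => inferInstance, u, Equiv.ofBijective _ hbij, ?_, fun i => ?_⟩
  · apply Subtype.ext
    have h : ∀ i, ((u i).1.map (Sigma.mk i)).map (fun x : Σ i, T i => x.2.1) = q i := fun i => by
      rw [← hu]
      simp only [OpTree.map, OpTree.bind_bind, OpTree.bind]
      rfl
    rw [ht]
    exact (congrArg₂ (OpTree.node e) (h 0) (h 1)).symm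
  · rw [hlen, ht, OpTree.leaves, List.length_append]
    have := hpos t₁
    have := hpos t₂
    fin_cases i <;> simp [q] <;> omega

namespace SymOperad

variable {k : Type u} [Field k] {E : Type u}

/-- A morphism out of the free operad is determined by the images of the corollas. -/
theorem freeOperad_hom_ext {Q : SymOperad.{u, w} k} {f g : Hom (freeOperad k E) Q}
    (h : ∀ e, f.app (Fin 2) (Finsupp.single (MTree.corolla e) 1) =
      g.app (Fin 2) (Finsupp.single (MTree.corolla e) 1)) : f = g := by
  -- The induction is on the number of leaves, with the label set left free, because the subtrees
  -- live on other label sets.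
  have key : ∀ (n : ℕ) (S : Type) [Finite S] (t : MTree E S), t.1.leaves.length = n →
      f.app S (Finsupp.single t 1) = g.app S (Finsupp.single t 1) := by
    intro n
    induction n using Nat.strong_induction_on with
    | _ n ih =>
      intro S _ t hn
      rcases ht : t.1 with s | ⟨e, t₁, t₂⟩
      · have hs : ∀ x, x = s := fun x => by
          have := t.2.2 x
          rw [ht] at this
          simpa [OpTree.leaves] using this
        -- A tree without vertices has a single label, so it is a relabelling of the operadic unit.
        let c : Unit ≃ S := ⟨fun _ => s, fun _ => (), fun _ => rfl, fun x => (hs x).symm⟩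
        have h1 : (Finsupp.single t 1 : MTree E S →₀ k) =
            (freeOperad k E).map c (freeOperad k E).one := by
          have : t = MTree.one.map c := Subtype.ext ht
          rw [this]
          exact Finsupp.mapDomain_single.symm
        rw [h1]
        refine (f.app_map c _).trans (Eq.trans ?_ (g.app_map c _).symm)
        rw [f.app_one, g.app_one]
      · obtain ⟨T, _, u, c, htc, hu⟩ := t.exists_eq_map_graft ht
        have h1 : (Finsupp.single t 1 : MTree E S →₀ k) =
            (freeOperad k E).map c ((freeOperad k E).comp
              (Finsupp.single (MTree.corolla e) 1 : MTree E (Fin 2) →₀ k)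
              (fun i => (Finsupp.single (u i) 1 : MTree E (T i) →₀ k))) := by
          rw [htc]
          refine Eq.trans ?_ (congrArg _ (freeComp_single k E _ u).symm)
          exact Finsupp.mapDomain_single.symm
        rw [h1]
        refine (f.app_map c _).trans (Eq.trans ?_ (g.app_map c _).symm)
        refine congrArg _ ((f.app_comp _ _).trans (Eq.trans ?_ (g.app_comp _ _).symm))
        rw [h]
        congr 1
        funext i
        exact ih _ (hn ▸ hu i) (T i) (u i) rfl
  refine Hom.ext_app fun S _ p => ?_
  have : f.app S = g.app S := Finsupp.lhom_ext' fun t => LinearMap.ext_ring (key _ S t rfl)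
  rw [this]

section freeEval

variable {V : Type v} [AddCommGroup V] [Module k V] (b : E → V →ₗ[k] V →ₗ[k] V)

/-- The multilinear operation given by a combination of multilinear tree monomials. -/
def evalLin (S : Type) : (MTree E S →₀ k) →ₗ[k] MultilinearMap k (fun _ : S => V) V :=
  Finsupp.linearCombination k fun t : MTree E S => t.evalMultilinear b

theorem evalLin_single {S : Type} (t : MTree E S) (a : k) (v : S → V) :
    evalLin b S (Finsupp.single t a) v = a • t.1.eval (fun e x y => b e x y) v := by
  rw [evalLin, Finsupp.linearCombination_single]
  rfl

theorem evalLin_map {S T : Type} (e : S ≃ T) (p : MTree E S →₀ k) (v : T → V) :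
    evalLin b T (Finsupp.mapDomain (MTree.map e) p) v = evalLin b S p fun s => v (e s) := by
  induction p using Finsupp.induction_linear with
  | zero => simp
  | add p p' h h' => simp only [Finsupp.mapDomain_add, map_add, add_apply, h, h']
  | single t a =>
    rw [Finsupp.mapDomain_single, evalLin_single, evalLin_single]
    exact congrArg (a • ·) (OpTree.eval_map _ _ _ _)

/-- Both sides are linear in `p` and multilinear in `q`, which reduces the claim to tree monomials;
there it is the substitution rule `OpTree.eval_bind`. -/
theorem evalLin_comp {S : Type} [Finite S] {T : S → Type} (p : MTree E S →₀ k)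
    (q : ∀ s, MTree E (T s) →₀ k) (v : (Σ s, T s) → V) :
    evalLin b _ (freeComp k E p q) v =
      evalLin b S p fun s => evalLin b (T s) (q s) fun t => v ⟨s, t⟩ := by
  induction p using Finsupp.induction_linear with
  | zero => simp
  | add p p' h h' => simp only [map_add, add_apply, h, h']
  | single t a =>
    rw [← mul_one a, ← smul_eq_mul, ← Finsupp.smul_single]
    simp only [map_smul, smul_apply]
    congr 1
    let ev (S : Type) (v : S → V) : MultilinearMap k (fun _ : S => V) V →ₗ[k] V :=
      { toFun := fun f => f v
        map_add' := fun _ _ => rfl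
        map_smul' := fun _ _ => rfl }
    have := Module.Basis.ext_multilinear
      (f := (ev _ v ∘ₗ evalLin b _).compMultilinearMap
        (freeComp k E (T := T) (Finsupp.single t 1)))
      (g := (evalLin b S (Finsupp.single t 1)).compLinearMap
        fun s => ev _ (fun t => v ⟨s, t⟩) ∘ₗ evalLin b (T s))
      (fun s => Finsupp.basisSingleOne) (fun u => by
        simp only [Finsupp.coe_basisSingleOne, LinearMap.compMultilinearMap_apply,
          MultilinearMap.compLinearMap_apply, freeComp_single, LinearMap.comp_apply]
        change evalLin b _ (Finsupp.single (t.graft u) 1) v = evalLin b S (Finsupp.single t 1)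
          fun s => evalLin b (T s) (Finsupp.single (u s) 1) fun t => v ⟨s, t⟩
        simp only [evalLin_single, one_smul]
        refine (OpTree.eval_bind _ _ _ _).trans ?_
        simp only [OpTree.eval_map])
    exact congrArg (fun f => f q) this

/-- The morphism from the free operad to an endomorphism operad given by the images of the
corollas. -/
def freeEval : Hom (freeOperad k E) (endOperad k V) where
  app S _ := evalLin b S
  app_map e p := MultilinearMap.ext fun v => evalLin_map b e p v
  app_one := MultilinearMap.ext fun v => by
    refine (evalLin_single b MTree.one 1 v).trans ?_
    rw [one_smul]
    rfl
  app_comp p q := MultilinearMap.ext fun v => evalLin_comp b p q v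

end freeEval

end SymOperad

/-! ### Algebras over a binary quadratic operad -/

namespace BinQuadData

variable {k : Type u} [Field k]

/-! ### Evaluation of cubic elements on a space with operations. -/

section evalTensor

variable {E : Type u} [AddCommGroup E] [Module k E] {V : Type v} [AddCommGroup V] [Module k V]

/-- The value at `x` of an element of the arity-three part of the free operad, when `e : E` acts
as the bilinear operation `b e`. -/
def evalTensor (b : E →ₗ[k] V →ₗ[k] V →ₗ[k] V) (x : Fin 3 → V) :
    (Fin 3 → E ⊗[k] E) →ₗ[k] V :=
  ∑ j : Fin 3, TensorProduct.lift (LinearMap.mk₂ k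
    (fun e f => b e (b f (x (j + 1)) (x (j + 2))) (x j))
    (fun _ _ _ => by simp) (fun _ _ _ => by simp) (fun _ _ _ => by simp)
    (fun _ _ _ => by simp)) ∘ₗ LinearMap.proj j

theorem evalTensor_single (b : E →ₗ[k] V →ₗ[k] V →ₗ[k] V) (x : Fin 3 → V) (j : Fin 3) (e f : E) :
    evalTensor b x (Pi.single j (e ⊗ₜ[k] f)) = b e (b f (x (j + 1)) (x (j + 2))) (x j) := by
  rw [evalTensor, LinearMap.sum_apply, Finset.sum_eq_single j]
  · simp
  · intro i _ hi
    simp [Pi.single_eq_of_ne hi]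
  · simp

theorem linearMap_ext_single {N : Type*} [AddCommGroup N] [Module k N]
    {f g : (Fin 3 → E ⊗[k] E) →ₗ[k] N}
    (h : ∀ j e e', f (Pi.single j (e ⊗ₜ[k] e')) = g (Pi.single j (e ⊗ₜ[k] e'))) : f = g :=
  LinearMap.pi_ext' fun j => TensorProduct.ext' fun e e' => h j e e'

theorem cubicAct_single (swap : E →ₗ[k] E) (σ : Equiv.Perm (Fin 3)) (j : Fin 3) (e f : E) :
    cubicAct swap σ (Pi.single j (e ⊗ₜ[k] f)) =
      Pi.single (σ j) (e ⊗ₜ[k] if Equiv.Perm.sign σ = 1 then f else swap f) := by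
  funext i
  by_cases hi : i = σ j
  · subst hi
    by_cases h : Equiv.Perm.sign σ = 1 <;> simp [cubicAct, h]
  · have : σ.symm i ≠ j := fun h => hi (by rw [← h]; simp)
    rw [Pi.single_eq_of_ne hi]
    simp [cubicAct, Pi.single_eq_of_ne this]

/-- The even permutations of `Fin 3` are the rotations, which commute with adding a constant; the
odd ones are the reflections, which turn `+ 1` into `+ 2`. -/
theorem perm_three_even : ∀ σ : Equiv.Perm (Fin 3), Equiv.Perm.sign σ = 1 → ∀ j : Fin 3,
    σ (j + 1) = σ j + 1 ∧ σ (j + 2) = σ j + 2 := by decide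

theorem perm_three_odd : ∀ σ : Equiv.Perm (Fin 3), Equiv.Perm.sign σ ≠ 1 → ∀ j : Fin 3,
    σ (j + 1) = σ j + 2 ∧ σ (j + 2) = σ j + 1 := by decide

/-- An odd `σ` exchanges the two inner arguments, and the swap applied to the inner operation
compensates for this by equivariance of `b`. -/
theorem evalTensor_cubicAct {b : E →ₗ[k] V →ₗ[k] V →ₗ[k] V} {swap : E →ₗ[k] E}
    (hb : ∀ e, b (swap e) = (b e).flip) (x : Fin 3 → V) (σ : Equiv.Perm (Fin 3))
    (r : Fin 3 → E ⊗[k] E) :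
    evalTensor b x (cubicAct swap σ r) = evalTensor b (fun i => x (σ i)) r := by
  have : evalTensor b x ∘ₗ cubicAct swap σ = evalTensor b fun i => x (σ i) := by
    refine linearMap_ext_single fun j e f => ?_
    rw [LinearMap.comp_apply, cubicAct_single, evalTensor_single, evalTensor_single]
    by_cases h : Equiv.Perm.sign σ = 1
    · obtain ⟨h1, h2⟩ := perm_three_even σ h j
      simp [h, h1, h2]
    · obtain ⟨h1, h2⟩ := perm_three_odd σ h j
      simp [h, h1, h2, hb]
  exact LinearMap.congr_fun this r

end evalTensor

/-! ### Generators of `P(E, R)`. -/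

section

variable (D : BinQuadData.{u} k)

theorem gen_add (e f : D.E) : D.gen (e + f) = D.gen e + D.gen f := by
  have h := SymOperad.subset_idealSpan (P := SymOperad.freeOperad k D.E)
    (A := fun S _ => {p | Rel D S p}) (Rel.add e f)
  rw [sub_sub] at h
  exact (Submodule.Quotient.eq _).2 h

theorem gen_smul (c : k) (e : D.E) : D.gen (c • e) = c • D.gen e :=
  (Submodule.Quotient.eq _).2 (SymOperad.subset_idealSpan (P := SymOperad.freeOperad k D.E)
    (A := fun S _ => {p | Rel D S p}) (Rel.smul c e))

theorem gen_swap (e : D.E) :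
    D.gen (D.swap e) = D.operad.map (Equiv.swap (0 : Fin 2) 1) (D.gen e) :=
  (Submodule.Quotient.eq _).2 (SymOperad.subset_idealSpan (P := SymOperad.freeOperad k D.E)
    (A := fun S _ => {p | Rel D S p}) (Rel.swap e))

variable {D}

theorem hom_ext {Q : SymOperad.{u, w} k} {φ ψ : SymOperad.Hom D.operad Q}
    (h : ∀ e, φ.app (Fin 2) (D.gen e) = ψ.app (Fin 2) (D.gen e)) : φ = ψ := by
  have : D.ideal.mkHom.trans φ = D.ideal.mkHom.trans ψ := SymOperad.freeOperad_hom_ext h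
  refine SymOperad.Hom.ext_app fun S _ p => ?_
  obtain ⟨p, rfl⟩ := Submodule.Quotient.mk_surjective _ p
  exact congrArg (fun χ => SymOperad.Hom.app χ S p) this

/-- The relations `Rel.quad` are imposed on formal combinations, so every element of `R` needs such
a representative. A linear functional killing the range kills all pure tensors, hence is zero. -/
theorem toTensor_surjective : Function.Surjective D.toTensor := by
  rw [← LinearMap.range_eq_top]
  by_contra hne
  obtain ⟨f, hf, hle⟩ := Submodule.exists_le_ker_of_lt_top _ (lt_top_iff_ne_top.2 hne)
  refine hf (linearMap_ext_single fun j e e' => ?_)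
  have : Pi.single j (e ⊗ₜ[k] e') ∈ LinearMap.range D.toTensor :=
    ⟨Finsupp.single (j, e, e') 1, by simp [toTensor]⟩
  exact hle this

end

/-! ### Algebras over `P(E, R)` as equivariant actions of `E` that kill `R`. -/

variable {D : BinQuadData.{u} k} {V : Type v} [AddCommGroup V] [Module k V]

theorem bilin_apply (f : MultilinearMap k (fun _ : Fin 2 => V) V) (x y : V) :
    SymOperad.bilin (k := k) f x y = f ![x, y] := rfl

theorem evalLin_corolla (b : D.E → V →ₗ[k] V →ₗ[k] V) (e : D.E) (v : Fin 2 → V) :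
    SymOperad.evalLin b (Fin 2) (D.freeGen e) v = b e (v 0) (v 1) := by
  refine (SymOperad.evalLin_single b (MTree.corolla e) 1 v).trans ?_
  rw [one_smul]
  rfl

theorem evalLin_mapDomain_cubic {E : Type u} [AddCommGroup E] [Module k E]
    (b : E →ₗ[k] V →ₗ[k] V →ₗ[k] V) (l : Fin 3 × E × E →₀ k) (x : Fin 3 → V) :
    SymOperad.evalLin b (Fin 3)
        (Finsupp.mapDomain (fun x => MTree.cubic x.1 x.2.1 x.2.2) l) x =
      evalTensor b x (Finsupp.linearCombination k
        (fun x : Fin 3 × E × E => Pi.single x.1 (x.2.1 ⊗ₜ[k] x.2.2)) l) := by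
  induction l using Finsupp.induction_linear with
  | zero => simp
  | add l l' h h' => simp only [Finsupp.mapDomain_add, map_add, add_apply, h, h']
  | single y a =>
    rw [Finsupp.mapDomain_single, Finsupp.linearCombination_single, map_smul, evalTensor_single,
      SymOperad.evalLin_single]
    rfl

theorem evalLin_toFree (b : D.E →ₗ[k] V →ₗ[k] V →ₗ[k] V) (l : Fin 3 × D.E × D.E →₀ k)
    (x : Fin 3 → V) :
    SymOperad.evalLin b (Fin 3) (D.toFree l) x = evalTensor b x (D.toTensor l) :=
  evalLin_mapDomain_cubic b l x

/-- The action of `E` on an algebra over `P(E, R)`. -/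
def genLin (φ : SymOperad.Hom D.operad (SymOperad.endOperad k V)) :
    D.E →ₗ[k] V →ₗ[k] V →ₗ[k] V where
  toFun e := SymOperad.bilin (φ.app (Fin 2) (D.gen e))
  map_add' e f := by rw [gen_add, map_add]; rfl
  map_smul' c e := by rw [gen_smul, map_smul]; rfl

theorem app_gen_apply (φ : SymOperad.Hom D.operad (SymOperad.endOperad k V)) (e : D.E)
    (v : Fin 2 → V) :
    DFunLike.coe (F := MultilinearMap k (fun _ : Fin 2 => V) V) (φ.app (Fin 2) (D.gen e)) v =
      genLin φ e (v 0) (v 1) := by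
  refine Eq.trans ?_ (bilin_apply _ _ _).symm
  congr 1
  funext i
  fin_cases i <;> rfl

theorem genLin_injective : Function.Injective
    (genLin : SymOperad.Hom D.operad (SymOperad.endOperad k V) → _) := by
  intro φ ψ h
  refine hom_ext fun e => MultilinearMap.ext fun v => ?_
  refine (app_gen_apply φ e v).trans (Eq.trans ?_ (app_gen_apply ψ e v).symm)
  rw [h]

theorem genLin_swap (φ : SymOperad.Hom D.operad (SymOperad.endOperad k V)) (e : D.E) :
    genLin φ (D.swap e) = (genLin φ e).flip := by
  ext x y
  have h : φ.app (Fin 2) (D.gen (D.swap e)) =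
      (SymOperad.endOperad k V).map (Equiv.swap (0 : Fin 2) 1) (φ.app (Fin 2) (D.gen e)) := by
    rw [gen_swap, φ.app_map]
  refine (app_gen_apply φ (D.swap e) ![x, y]).symm.trans ?_
  rw [h]
  exact app_gen_apply φ e _

/-- Tree evaluation by `genLin φ` and the projection followed by `φ` agree on corollas, hence
everywhere; the projection sends a representative of `r` to zero. -/
theorem evalTensor_genLin (φ : SymOperad.Hom D.operad (SymOperad.endOperad k V)) (x : Fin 3 → V)
    {r : Fin 3 → D.E ⊗[k] D.E} (hr : r ∈ D.R) : evalTensor (genLin φ) x r = 0 := by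
  obtain ⟨l, rfl⟩ := toTensor_surjective r
  have h : SymOperad.freeEval (genLin φ) = D.ideal.mkHom.trans φ :=
    SymOperad.freeOperad_hom_ext fun e => MultilinearMap.ext fun v =>
      (evalLin_corolla _ e v).trans (app_gen_apply φ e v).symm
  have h0 : D.ideal.mkHom.app (Fin 3) (D.toFree l) = 0 :=
    (Submodule.Quotient.mk_eq_zero _).2 (SymOperad.subset_idealSpan
      (P := SymOperad.freeOperad k D.E) (A := fun S _ => {p | Rel D S p}) (Rel.quad l hr))
  have h1 : (SymOperad.freeEval (genLin φ)).app (Fin 3) (D.toFree l) = 0 := by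
    rw [h]
    exact (congrArg (φ.app (Fin 3)) h0).trans (map_zero _)
  rw [← evalLin_toFree]
  exact congrArg (fun f : MultilinearMap k (fun _ : Fin 3 => V) V => f x) h1

/-- The kernel of tree evaluation is an operadic ideal. It contains the linearity relations because
`b` is linear, the swap relations by `hb` and the quadratic ones by `hR`. So evaluation descends to
the quotient. -/
theorem exists_genLin_eq {b : D.E →ₗ[k] V →ₗ[k] V →ₗ[k] V} (hb : ∀ e, b (D.swap e) = (b e).flip)
    (hR : ∀ r ∈ D.R, ∀ x, evalTensor b x r = 0) :
    ∃ φ : SymOperad.Hom D.operad (SymOperad.endOperad k V), genLin φ = b := by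
  have hle : ∀ (S : Type) [Finite S],
      {p | Rel D S p} ⊆ ((SymOperad.freeEval b).ker.carrier S : Set _) := by
    rintro S _ p (⟨e, f⟩ | ⟨c, e⟩ | e | ⟨l, hl⟩)
    · refine MultilinearMap.ext fun v => ?_
      refine (congrArg (fun f : MultilinearMap k (fun _ : Fin 2 => V) V => f v)
        ((map_sub (SymOperad.evalLin b (Fin 2)) _ _).trans
          (congrArg (· - _) (map_sub (SymOperad.evalLin b (Fin 2)) _ _)))).trans ?_
      simp [evalLin_corolla]
      rfl
    · refine MultilinearMap.ext fun v => ?_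
      refine (congrArg (fun f : MultilinearMap k (fun _ : Fin 2 => V) V => f v)
        ((map_sub (SymOperad.evalLin b (Fin 2)) _ _).trans
          (congrArg (_ - ·) (map_smul (SymOperad.evalLin b (Fin 2)) _ _)))).trans ?_
      simp [evalLin_corolla]
      rfl
    · refine MultilinearMap.ext fun v => ?_
      refine (congrArg (fun f : MultilinearMap k (fun _ : Fin 2 => V) V => f v)
        (map_sub (SymOperad.evalLin b (Fin 2)) _ _)).trans ?_
      refine (congrArg₂ (· - ·) (evalLin_corolla b _ v)
        ((SymOperad.evalLin_map b _ _ _).trans (evalLin_corolla b e _))).trans ?_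
      simp [hb]
      rfl
    · refine MultilinearMap.ext fun x => ?_
      exact (evalLin_toFree b l x).trans (hR _ hl x)
  refine ⟨D.ideal.lift (SymOperad.freeEval b) fun S _ =>
    SymOperad.idealSpan_le (SymOperad.freeEval b).ker hle S, ?_⟩
  ext e x y
  exact evalLin_corolla b e ![x, y]

/-! #### Operads presented by operations without symmetry -/

section ofIdentities

variable {Ω : Type}

/-- The linear action of the free `S₂`-module on the operations `B a`. -/
def regEval (B : Ω → V →ₗ[k] V →ₗ[k] V) : RegE k Ω →ₗ[k] V →ₗ[k] V →ₗ[k] V :=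
  Finsupp.linearCombination k fun p => if p.2 then (B p.1).flip else B p.1

theorem regSwap_single (a : Ω) (i : Bool) (c : k) :
    regSwap k Ω (Finsupp.single (a, i) c) = Finsupp.single (a, !i) c := by
  rw [regSwap, Finsupp.lmapDomain_apply, Finsupp.mapDomain_single]
  rfl

theorem regSwap_op (a : Ω) : regSwap k Ω (op k a) = Finsupp.single (a, true) 1 :=
  regSwap_single a false 1

theorem regEval_op (B : Ω → V →ₗ[k] V →ₗ[k] V) (a : Ω) : regEval B (op k a) = B a := by
  simp [regEval, op]

theorem regEval_swap (B : Ω → V →ₗ[k] V →ₗ[k] V) (e : RegE k Ω) :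
    regEval B (regSwap k Ω e) = (regEval B e).flip := by
  induction e using Finsupp.induction_linear with
  | zero => simp; rfl
  | add e e' h h' => rw [map_add, map_add, map_add, h, h']; rfl
  | single p c =>
    rcases p with ⟨a, i⟩
    rw [regSwap_single]
    cases i <;> simp [regEval] <;> rfl

/-- Freeness of `RegE k Ω` as an `S₂`-module: an equivariant map is determined by its values on the
operations `op k a`. -/
theorem eq_regEval {b : RegE k Ω →ₗ[k] V →ₗ[k] V →ₗ[k] V}
    (hb : ∀ e, b (regSwap k Ω e) = (b e).flip) : b = regEval fun a => b (op k a) := by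
  refine Finsupp.lhom_ext' fun p => LinearMap.ext_ring ?_
  rcases p with ⟨a, i⟩
  cases i
  · simp [regEval, op]
  · have := hb (op k a)
    rw [regSwap_op] at this
    simp [regEval, this]

theorem evalTensor_left (B : Ω → V →ₗ[k] V →ₗ[k] V) (x : Fin 3 → V) (σ : Equiv.Perm (Fin 3))
    (a b : Ω) :
    evalTensor (regEval B) x (left k σ a b) = B b (B a (x (σ 0)) (x (σ 1))) (x (σ 2)) := by
  rw [left, evalTensor_cubicAct (regEval_swap B), evalTensor_single, regEval_op, regEval_op]
  rfl

theorem evalTensor_right (B : Ω → V →ₗ[k] V →ₗ[k] V) (x : Fin 3 → V) (σ : Equiv.Perm (Fin 3))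
    (a b : Ω) :
    evalTensor (regEval B) x (right k σ a b) = B a (x (σ 0)) (B b (x (σ 1)) (x (σ 2))) := by
  rw [right, evalTensor_cubicAct (regEval_swap B), evalTensor_single, regEval_swap, regEval_op,
    regEval_op]
  rfl

/-- Evaluating a relabelled identity amounts to evaluating the identity at permuted arguments, and
the identities are required at all arguments. Closing `A` under relabelling and linear combinations
thus adds no condition. -/
theorem evalTensor_eq_zero_iff (B : Ω → V →ₗ[k] V →ₗ[k] V)
    (A : Set (Fin 3 → RegE k Ω ⊗[k] RegE k Ω)) :
    (∀ r ∈ Submodule.span k {x | ∃ σ : Equiv.Perm (Fin 3), ∃ r ∈ A,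
      x = cubicAct (regSwap k Ω) σ r}, ∀ x, evalTensor (regEval B) x r = 0) ↔
      ∀ r ∈ A, ∀ x, evalTensor (regEval B) x r = 0 := by
  constructor
  · refine fun h r hr x => h r (Submodule.subset_span ⟨1, r, hr, ?_⟩) x
    funext i
    simp [cubicAct]
  · intro h r hr x
    induction hr using Submodule.span_induction with
    | mem r hr =>
      obtain ⟨σ, r, hr, rfl⟩ := hr
      rw [evalTensor_cubicAct (regEval_swap B)]
      exact h r hr _
    | zero => exact map_zero _
    | add r r' _ _ h h' => rw [map_add, h, h', add_zero]
    | smul c r _ h => rw [map_smul, h, smul_zero]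

/-- The hypothesis `hΩ` expresses that `a` and `b` exhaust `Ω`: a function on `Ω` is known from its
values at these two operations. -/
theorem algebrasAre_ofIdentities [Finite Ω] (A : Set (Fin 3 → RegE k Ω ⊗[k] RegE k Ω)) (a b : Ω)
    (hΩ : ∀ {α : Type v} (f g : Ω → α), f a = g a → f b = g b → f = g)
    {P : (V →ₗ[k] V →ₗ[k] V) → (V →ₗ[k] V →ₗ[k] V) → Prop}
    (hP : ∀ m s, P m s ↔ ∃ B : Ω → V →ₗ[k] V →ₗ[k] V, B a = m ∧ B b = s ∧
      ∀ r ∈ A, ∀ x, evalTensor (regEval B) x r = 0) :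
    (ofIdentities Ω A).operad.AlgebrasAre ((ofIdentities Ω A).gen (op k a))
      ((ofIdentities Ω A).gen (op k b)) V P := by
  have hgen (φ : SymOperad.Hom (ofIdentities Ω A).operad (SymOperad.endOperad k V)) :
      genLin φ = regEval fun c => genLin φ (op k c : RegE k Ω) :=
    eq_regEval (genLin_swap φ)
  constructor
  · intro φ ψ h
    obtain ⟨h1, h2⟩ := Prod.ext_iff.1 h
    apply genLin_injective
    rw [hgen φ, hgen ψ]
    exact congrArg regEval (hΩ _ _ h1 h2)
  · ext ⟨m, s⟩
    refine Iff.trans ?_ (hP m s).symm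
    constructor
    · rintro ⟨φ, hφ⟩
      obtain ⟨rfl, rfl⟩ := Prod.ext_iff.1 hφ
      refine ⟨fun c => genLin φ (op k c : RegE k Ω), rfl, rfl,
        (evalTensor_eq_zero_iff _ A).1 fun r hr x => ?_⟩
      rw [← hgen]
      exact evalTensor_genLin φ x hr
    · rintro ⟨B, rfl, rfl, hB⟩
      obtain ⟨φ, hφ⟩ := exists_genLin_eq (D := ofIdentities Ω A) (b := regEval B)
        (regEval_swap B) ((evalTensor_eq_zero_iff B A).2 hB)
      refine ⟨φ, Prod.ext ?_ ?_⟩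
      · exact (congrArg (fun f => f (op k a)) hφ).trans (regEval_op B a)
      · exact (congrArg (fun f => f (op k b)) hφ).trans (regEval_op B b)

end ofIdentities

end BinQuadData

/-! ### Functoriality in the quadratic data -/

section relabel

variable {E E' : Type u} {X Y : Type}

/-- Change of the labels of the vertices. -/
def OpTree.relabel (g : E → E') : OpTree E X → OpTree E' X
  | leaf x => leaf x
  | node e t t' => node (g e) (t.relabel g) (t'.relabel g)

theorem OpTree.leaves_relabel (g : E → E') (t : OpTree E X) :
    (t.relabel g).leaves = t.leaves := by
  induction t with
  | leaf x => rfl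
  | node e t t' h h' => simp [relabel, leaves, h, h']

theorem OpTree.relabel_bind (g : E → E') (t : OpTree E X) (f : X → OpTree E Y) :
    (t.bind f).relabel g = (t.relabel g).bind fun x => (f x).relabel g := by
  induction t with
  | leaf x => rfl
  | node e t t' h h' => simp [relabel, bind, h, h']

theorem OpTree.relabel_map (g : E → E') (t : OpTree E X) (f : X → Y) :
    (t.map f).relabel g = (t.relabel g).map f :=
  relabel_bind g t _

/-- Change of the labels of the vertices. -/
def MTree.relabel (g : E → E') (t : MTree E X) : MTree E' X :=
  ⟨t.1.relabel g, by rw [OpTree.leaves_relabel]; exact t.2⟩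

theorem MTree.relabel_map (g : E → E') (t : MTree E X) (f : X ≃ Y) :
    (t.map f).relabel g = (t.relabel g).map f :=
  Subtype.ext (OpTree.relabel_map g t.1 f)

theorem MTree.relabel_graft (g : E → E') {T : X → Type} (t : MTree E X)
    (u : ∀ x, MTree E (T x)) :
    (t.graft u).relabel g = (t.relabel g).graft fun x => (u x).relabel g := by
  apply Subtype.ext
  refine (OpTree.relabel_bind g _ _).trans ?_
  simp only [OpTree.relabel_map]
  rfl

theorem SymOperad.freeComp_relabel (k : Type u) [Field k] (g : E → E') {S : Type} [Finite S]
    {T : S → Type} (p : MTree E S →₀ k) (q : ∀ s, MTree E (T s) →₀ k) :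
    Finsupp.lmapDomain k k (MTree.relabel g) (freeComp k E p q) =
      freeComp k E' (Finsupp.lmapDomain k k (MTree.relabel g) p)
        fun s => Finsupp.lmapDomain k k (MTree.relabel g) (q s) := by
  induction p using Finsupp.induction_linear with
  | zero => simp
  | add p p' h h' => simp only [map_add, add_apply, h, h']
  | single t a =>
    rw [← mul_one a, ← smul_eq_mul, ← Finsupp.smul_single]
    simp only [map_smul, smul_apply]
    congr 1
    have := multilinear_ext k
      (f := (Finsupp.lmapDomain k k (MTree.relabel g)).compMultilinearMap
        (freeComp k E (T := T) (Finsupp.single t 1)))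
      (g := (freeComp k E' (T := T) (Finsupp.single (t.relabel g) 1)).compLinearMap
        fun s => Finsupp.lmapDomain k k (MTree.relabel g)) (fun u => by
        simp only [MultilinearMap.compLinearMap_apply, LinearMap.compMultilinearMap_apply,
          Finsupp.lmapDomain_apply, Finsupp.mapDomain_single, freeComp_single,
          MTree.relabel_graft])
    rw [Finsupp.lmapDomain_apply, Finsupp.lmapDomain_apply, Finsupp.mapDomain_single]
    exact congrArg (fun f => f q) this

/-- The morphism of free operads induced by a map of the sets of generators. -/
def SymOperad.freeMap (k : Type u) [Field k] (g : E → E') :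
    Hom (freeOperad k E) (freeOperad k E') where
  app S _ := Finsupp.lmapDomain k k (MTree.relabel g)
  app_map e p := by
    refine (Finsupp.mapDomain_comp (v := p)).symm.trans
      (Eq.trans ?_ (Finsupp.mapDomain_comp (v := p)))
    exact congrArg (Finsupp.mapDomain · p) (funext fun t => MTree.relabel_map g t e)
  app_one := Finsupp.mapDomain_single
  app_comp p q := freeComp_relabel k g p q

end relabel

namespace BinQuadData

variable {k : Type u} [Field k]

/-- The map induced on the arity-three parts by a map of the operations. -/
def mapTensor {E E' : Type u} [AddCommGroup E] [Module k E] [AddCommGroup E'] [Module k E']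
    (g : E →ₗ[k] E') : (Fin 3 → E ⊗[k] E) →ₗ[k] (Fin 3 → E' ⊗[k] E') :=
  LinearMap.pi fun j => TensorProduct.map g g ∘ₗ LinearMap.proj j

theorem mapTensor_single {E E' : Type u} [AddCommGroup E] [Module k E] [AddCommGroup E']
    [Module k E'] (g : E →ₗ[k] E') (j : Fin 3) (e f : E) :
    mapTensor g (Pi.single j (e ⊗ₜ[k] f)) = Pi.single j (g e ⊗ₜ[k] g f) := by
  funext i
  by_cases h : i = j
  · subst h; simp [mapTensor]
  · simp [mapTensor, Pi.single_eq_of_ne h]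

theorem mapTensor_symm_apply {E E' : Type u} [AddCommGroup E] [Module k E] [AddCommGroup E']
    [Module k E'] (g : E ≃ₗ[k] E') (r : Fin 3 → E' ⊗[k] E') :
    mapTensor g.toLinearMap (mapTensor g.symm.toLinearMap r) = r := by
  have : mapTensor g.toLinearMap ∘ₗ mapTensor g.symm.toLinearMap = LinearMap.id :=
    linearMap_ext_single fun j e e' => by
      rw [LinearMap.comp_apply, mapTensor_single, mapTensor_single]
      simp
  exact LinearMap.congr_fun this r

variable {D D' : BinQuadData.{u} k}

theorem toTensor_mapDomain (g : D.E →ₗ[k] D'.E) (l : Fin 3 × D.E × D.E →₀ k) :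
    D'.toTensor (Finsupp.mapDomain (fun x => (x.1, g x.2.1, g x.2.2)) l) =
      mapTensor g (D.toTensor l) := by
  induction l using Finsupp.induction_linear with
  | zero => simp
  | add l l' h h' => rw [Finsupp.mapDomain_add, map_add, map_add, map_add, h, h']
  | single x a =>
    rw [Finsupp.mapDomain_single, toTensor, toTensor, Finsupp.linearCombination_single,
      Finsupp.linearCombination_single, map_smul, mapTensor_single]

theorem freeMap_freeGen (g : D.E → D'.E) (e : D.E) :
    (SymOperad.freeMap k g).app (Fin 2) (D.freeGen e) = D'.freeGen (g e) :=
  Finsupp.mapDomain_single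

theorem freeMap_toFree (g : D.E →ₗ[k] D'.E) (l : Fin 3 × D.E × D.E →₀ k) :
    (SymOperad.freeMap k g).app (Fin 3) (D.toFree l) =
      D'.toFree (Finsupp.mapDomain (fun x => (x.1, g x.2.1, g x.2.2)) l) :=
  (Finsupp.mapDomain_comp (f := fun x : Fin 3 × D.E × D.E => MTree.cubic x.1 x.2.1 x.2.2)
    (g := MTree.relabel g) (v := l)).symm.trans
    (Finsupp.mapDomain_comp (f := fun x : Fin 3 × D.E × D.E => (x.1, g x.2.1, g x.2.2))
      (g := fun x : Fin 3 × D'.E × D'.E => MTree.cubic x.1 x.2.1 x.2.2) (v := l))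

/-- The morphism of operads induced by a morphism of quadratic data. -/
def mapHom (g : D.E →ₗ[k] D'.E) (hs : ∀ e, g (D.swap e) = D'.swap (g e))
    (hR : ∀ r ∈ D.R, mapTensor g r ∈ D'.R) : SymOperad.Hom D.operad D'.operad :=
  D.ideal.lift ((SymOperad.freeMap k g).trans D'.ideal.mkHom) fun S _ =>
    SymOperad.idealSpan_le ((SymOperad.freeMap k g).trans D'.ideal.mkHom).ker (by
      intro S _ p hp
      refine (Submodule.Quotient.mk_eq_zero _).2 (SymOperad.subset_idealSpan
        (P := SymOperad.freeOperad k D'.E) (A := fun S _ => {p | Rel D' S p}) ?_)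
      rcases hp with ⟨e, f⟩ | ⟨c, e⟩ | e | ⟨l, hl⟩
      · rw [map_sub, map_sub, freeMap_freeGen, freeMap_freeGen, freeMap_freeGen, map_add]
        exact Rel.add _ _
      · rw [map_sub, map_smul, freeMap_freeGen, freeMap_freeGen, map_smul]
        exact Rel.smul _ _
      · rw [map_sub, SymOperad.Hom.app_map, freeMap_freeGen, freeMap_freeGen, hs]
        exact Rel.swap _
      · rw [freeMap_toFree]
        refine Rel.quad _ ?_
        rw [toTensor_mapDomain]
        exact hR _ hl) S

theorem mapHom_gen (g : D.E →ₗ[k] D'.E) (hs : ∀ e, g (D.swap e) = D'.swap (g e))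
    (hR : ∀ r ∈ D.R, mapTensor g r ∈ D'.R) (e : D.E) :
    (mapHom g hs hR).app (Fin 2) (D.gen e) = D'.gen (g e) :=
  congrArg (D'.ideal.mkHom.app (Fin 2)) (freeMap_freeGen g e)

/-- The identity of an operad. -/
def _root_.SymOperad.Hom.refl (P : SymOperad.{u, v} k) : SymOperad.Hom P P where
  app _ _ := LinearMap.id
  app_map _ _ := rfl
  app_one := rfl
  app_comp _ _ := rfl

/-- Isomorphic quadratic data present isomorphic operads. -/
theorem exists_isIso (g : D.E ≃ₗ[k] D'.E) (hs : ∀ e, g (D.swap e) = D'.swap (g e))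
    (hR : ∀ r, mapTensor g.toLinearMap r ∈ D'.R ↔ r ∈ D.R) :
    ∃ f : SymOperad.Hom D.operad D'.operad, f.IsIso ∧
      ∀ e, f.app (Fin 2) (D.gen e) = D'.gen (g e) := by
  have hs' : ∀ e, g.symm (D'.swap e) = D.swap (g.symm e) := fun e => by
    rw [LinearEquiv.symm_apply_eq, hs, LinearEquiv.apply_symm_apply]
  have hR' : ∀ r ∈ D'.R, mapTensor g.symm.toLinearMap r ∈ D.R := fun r hr => by
    rwa [← hR, mapTensor_symm_apply]
  have h := mapHom_gen g.toLinearMap hs fun r hr => (hR r).2 hr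
  have h' := mapHom_gen g.symm.toLinearMap hs' hR'
  refine ⟨mapHom g.toLinearMap hs fun r hr => (hR r).2 hr, fun S _ => ?_, h⟩
  -- Both composites fix every generator, so by `hom_ext` they are identities.
  have h1 : (mapHom g.toLinearMap hs fun r hr => (hR r).2 hr).trans
      (mapHom g.symm.toLinearMap hs' hR') = SymOperad.Hom.refl _ := hom_ext fun e =>
    (congrArg _ (h e)).trans ((h' _).trans (congrArg D.gen (g.symm_apply_apply e)))
  have h2 : (mapHom g.symm.toLinearMap hs' hR').trans
      (mapHom g.toLinearMap hs fun r hr => (hR r).2 hr) = SymOperad.Hom.refl _ := hom_ext fun e =>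
    (congrArg _ (h' e)).trans ((h _).trans (congrArg D'.gen (g.apply_symm_apply e)))
  exact Function.bijective_iff_has_inverse.2
    ⟨(mapHom g.symm.toLinearMap hs' hR').app S,
      fun p => congrArg (fun χ => SymOperad.Hom.app χ S p) h1,
      fun p => congrArg (fun χ => SymOperad.Hom.app χ S p) h2⟩

end BinQuadData

/-! ### The orthogonal complement in terms of monomials -/

namespace BinQuadData

variable {k : Type u} [Field k]

section monomials

variable {Ω : Type}

/-- Left and right monomials are told apart by the flag of the outer operation (`false` for left,
`true` for right). The permutation is encoded by the component of the tensor together with the flag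
of the inner operation, which records the parity of `σ`. -/
theorem left_eq_single (σ : Equiv.Perm (Fin 3)) (a b : Ω) :
    left k σ a b = Pi.single (σ 2) (Finsupp.single (b, false) 1 ⊗ₜ[k]
      Finsupp.single (a, decide (Equiv.Perm.sign σ ≠ 1)) 1) := by
  rw [left, cubicAct_single, regSwap_op]
  by_cases h : Equiv.Perm.sign σ = 1 <;> simp [h, op]

theorem right_eq_single (σ : Equiv.Perm (Fin 3)) (a b : Ω) :
    right k σ a b = Pi.single (σ 0) (Finsupp.single (a, true) 1 ⊗ₜ[k]
      Finsupp.single (b, decide (Equiv.Perm.sign σ ≠ 1)) 1) := by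
  rw [right, cubicAct_single, regSwap_op, regSwap_op]
  by_cases h : Equiv.Perm.sign σ = 1 <;> simp [h, op]

/-- A permutation of three points amounts to the image of one chosen point together with a sign:
there are `3 · 2 = 6` of each. This makes the indexing of monomials by permutations a bijection. -/
theorem exists_perm_two : ∀ (j : Fin 3) (i : Bool), ∃ σ : Equiv.Perm (Fin 3),
    σ 2 = j ∧ decide (Equiv.Perm.sign σ ≠ 1) = i := by decide

theorem exists_perm_zero : ∀ (j : Fin 3) (i : Bool), ∃ σ : Equiv.Perm (Fin 3),
    σ 0 = j ∧ decide (Equiv.Perm.sign σ ≠ 1) = i := by decide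

theorem perm_eq_iff_two : ∀ σ τ : Equiv.Perm (Fin 3),
    σ = τ ↔ σ 2 = τ 2 ∧ Equiv.Perm.sign σ = Equiv.Perm.sign τ := by decide

theorem perm_eq_iff_zero : ∀ σ τ : Equiv.Perm (Fin 3),
    σ = τ ↔ σ 0 = τ 0 ∧ Equiv.Perm.sign σ = Equiv.Perm.sign τ := by decide

/-- The monomials span the arity-three part of the free operad. -/
theorem linearMap_ext_monomials {N : Type*} [AddCommGroup N] [Module k N]
    {f g : (Fin 3 → RegE k Ω ⊗[k] RegE k Ω) →ₗ[k] N}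
    (hl : ∀ σ a b, f (left k σ a b) = g (left k σ a b))
    (hr : ∀ σ a b, f (right k σ a b) = g (right k σ a b)) : f = g := by
  refine LinearMap.pi_ext' fun j => TensorProduct.ext ?_
  refine Finsupp.lhom_ext' fun ⟨a, i⟩ => LinearMap.ext_ring (Finsupp.lhom_ext' fun ⟨b, i'⟩ =>
    LinearMap.ext_ring ?_)
  cases i
  · obtain ⟨σ, rfl, rfl⟩ := exists_perm_two j i'
    have := hl σ b a
    rwa [left_eq_single] at this
  · obtain ⟨σ, rfl, rfl⟩ := exists_perm_zero j i'
    have := hr σ a b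
    rwa [right_eq_single] at this

theorem cubicAct_left (σ τ : Equiv.Perm (Fin 3)) (a b : Ω) :
    cubicAct (regSwap k Ω) σ (left k τ a b) = left k (σ * τ) a b :=
  (cubicAct_mul _ (regSwap_regSwap Ω) σ τ _).symm

theorem cubicAct_right (σ τ : Equiv.Perm (Fin 3)) (a b : Ω) :
    cubicAct (regSwap k Ω) σ (right k τ a b) = right k (σ * τ) a b :=
  (cubicAct_mul _ (regSwap_regSwap Ω) σ τ _).symm

end monomials

theorem mapTensor_cubicAct {E E' : Type u} [AddCommGroup E] [Module k E] [AddCommGroup E']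
    [Module k E'] (g : E →ₗ[k] E') {swap : E →ₗ[k] E} {swap' : E' →ₗ[k] E'}
    (h : ∀ e, g (swap e) = swap' (g e)) (σ : Equiv.Perm (Fin 3)) (r : Fin 3 → E ⊗[k] E) :
    mapTensor g (cubicAct swap σ r) = cubicAct swap' σ (mapTensor g r) := by
  have : mapTensor g ∘ₗ cubicAct swap σ = cubicAct swap' σ ∘ₗ mapTensor g :=
    linearMap_ext_single fun j e f => by
      rw [LinearMap.comp_apply, LinearMap.comp_apply, cubicAct_single, mapTensor_single,
        mapTensor_single, cubicAct_single]
      by_cases hσ : Equiv.Perm.sign σ = 1 <;> simp [hσ, h]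
  exact LinearMap.congr_fun this r

/-! ### The sign-twisted dual basis and the diagonal form of the pairing. -/

section dual

variable {Ω Ω' : Type} (ι : Ω' ≃ Ω)

/-- The operation `a` is sent to the coordinate of `ι a`, its opposite to minus the coordinate of
the opposite of `ι a`. -/
def toDual : RegE k Ω' →ₗ[k] Module.Dual k (RegE k Ω) :=
  Finsupp.linearCombination k fun p =>
    (if p.2 then (-1 : k) else 1) • Finsupp.lapply (ι p.1, p.2)

theorem toDual_single_single (p : Ω' × Bool) (q : Ω × Bool) [Decidable ((ι p.1, p.2) = q)] :
    toDual ι (Finsupp.single p (1 : k)) (Finsupp.single q 1) =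
      if (ι p.1, p.2) = q then (if p.2 then (-1 : k) else 1) else 0 := by
  classical
  rw [toDual, Finsupp.linearCombination_single, one_smul, LinearMap.smul_apply,
    Finsupp.lapply_apply, Finsupp.single_apply]
  by_cases h : (ι p.1, p.2) = q <;> simp [h, eq_comm (a := q)]

theorem toDual_op (a : Ω') : toDual ι (op k a) = Finsupp.lapply (ι a, false) := by
  simp [toDual, op]

/-- This is the reason for the minus sign in `toDual`: the action on `E^∨` is twisted by the
signature, so the transposition sends the coordinate of an operation to minus the coordinate of its
opposite. -/
theorem toDual_swap (e : RegE k Ω') :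
    toDual ι (regSwap k Ω' e) = (-(regSwap k Ω).dualMap) (toDual ι e) := by
  classical
  have : toDual ι ∘ₗ regSwap k Ω' = (-(regSwap k Ω).dualMap) ∘ₗ toDual ι := by
    refine Finsupp.lhom_ext' fun ⟨a, i⟩ => LinearMap.ext_ring (Finsupp.lhom_ext' fun ⟨b, i'⟩ =>
      LinearMap.ext_ring ?_)
    change toDual ι (regSwap k Ω' (Finsupp.single (a, i) 1)) (Finsupp.single (b, i') 1) =
      -(toDual ι (Finsupp.single (a, i) 1) (regSwap k Ω (Finsupp.single (b, i') 1)))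
    rw [regSwap_single, regSwap_single, toDual_single_single, toDual_single_single]
    by_cases h : ι a = b <;> cases i <;> cases i' <;> simp [h]
  exact LinearMap.congr_fun this e

theorem toDual_apply_single (e : RegE k Ω') (a : Ω') (i : Bool) :
    toDual ι e (Finsupp.single (ι a, i) 1) = (if i then -1 else 1) * e (a, i) := by
  classical
  induction e using Finsupp.induction_linear with
  | zero => simp
  | add e e' h h' => rw [map_add, LinearMap.add_apply, h, h', Finsupp.add_apply, mul_add]
  | single p c =>
    rw [← mul_one c, ← smul_eq_mul, ← Finsupp.smul_single, map_smul, LinearMap.smul_apply,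
      toDual_single_single, Finsupp.smul_apply, Finsupp.single_apply]
    rcases p with ⟨b, j⟩
    by_cases h : b = a <;> cases i <;> cases j <;> simp [h]

theorem toDual_injective : Function.Injective (toDual ι : RegE k Ω' →ₗ[k] _) := by
  rw [injective_iff_map_eq_zero]
  intro e he
  ext ⟨a, i⟩
  have := toDual_apply_single ι e a i
  rw [he] at this
  cases i <;> simpa [eq_comm] using this

/-- `toDual` as an isomorphism. -/
def toDualEquiv [Finite Ω] [Finite Ω'] : RegE k Ω' ≃ₗ[k] Module.Dual k (RegE k Ω) :=
  LinearEquiv.ofInjectiveOfFinrankEq (toDual ι) (toDual_injective ι) (by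
    have := Fintype.ofFinite Ω
    have := Fintype.ofFinite Ω'
    rw [Subspace.dual_finrank_eq, Module.finrank_finsupp_self, Module.finrank_finsupp_self,
      Fintype.card_prod, Fintype.card_prod, Fintype.card_congr ι])

theorem pairing_mapTensor_single (i j : Fin 3) (p q : Ω' × Bool) (r s : Ω × Bool) :
    pairing (mapTensor (toDual ι) (Pi.single i
        (Finsupp.single p (1 : k) ⊗ₜ[k] Finsupp.single q (1 : k))))
      (Pi.single j (Finsupp.single r (1 : k) ⊗ₜ[k] Finsupp.single s (1 : k))) =
      if i = j then toDual ι (Finsupp.single p (1 : k)) (Finsupp.single r 1) *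
        toDual ι (Finsupp.single q (1 : k)) (Finsupp.single s 1) else 0 := by
  rw [mapTensor_single, pairing_apply, Finset.sum_eq_single i]
  · by_cases h : i = j
    · subst h; simp
    · simp [h]
  · intro l _ hl
    simp [Pi.single_eq_of_ne hl]
  · simp

variable [DecidableEq Ω]

/-- The outer operations are not opposite and contribute `1`. The inner one is opposite exactly when
`σ` is odd and contributes `sign σ`. -/
theorem pairing_left_left (σ τ : Equiv.Perm (Fin 3)) (a b : Ω') (c d : Ω) :
    pairing (mapTensor (toDual ι) (left k σ a b)) (left k τ c d) =
      if σ = τ ∧ ι a = c ∧ ι b = d then ((Equiv.Perm.sign σ : ℤ) : k) else 0 := by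
  rw [left_eq_single, left_eq_single, pairing_mapTensor_single, toDual_single_single,
    toDual_single_single]
  simp only [perm_eq_iff_two σ τ]
  rcases Int.units_eq_one_or (Equiv.Perm.sign σ) with h | h <;>
    rcases Int.units_eq_one_or (Equiv.Perm.sign τ) with h' | h' <;>
    by_cases h1 : σ 2 = τ 2 <;> by_cases h2 : ι a = c <;> by_cases h3 : ι b = d <;>
    simp [h, h', h1, h2, h3]

/-- Compared with left monomials, the outer operation is now an opposite one and contributes an
additional `-1`. -/
theorem pairing_right_right (σ τ : Equiv.Perm (Fin 3)) (a b : Ω') (c d : Ω) :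
    pairing (mapTensor (toDual ι) (right k σ a b)) (right k τ c d) =
      if σ = τ ∧ ι a = c ∧ ι b = d then -((Equiv.Perm.sign σ : ℤ) : k) else 0 := by
  rw [right_eq_single, right_eq_single, pairing_mapTensor_single, toDual_single_single,
    toDual_single_single]
  simp only [perm_eq_iff_zero σ τ]
  rcases Int.units_eq_one_or (Equiv.Perm.sign σ) with h | h <;>
    rcases Int.units_eq_one_or (Equiv.Perm.sign τ) with h' | h' <;>
    by_cases h1 : σ 0 = τ 0 <;> by_cases h2 : ι a = c <;> by_cases h3 : ι b = d <;>
    simp [h, h', h1, h2, h3]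

/-- The outer operations have different flags, so the outer factor of the pairing vanishes. -/
theorem pairing_left_right (σ τ : Equiv.Perm (Fin 3)) (a b : Ω') (c d : Ω) :
    pairing (mapTensor (toDual ι) (left k σ a b)) (right k τ c d) = 0 := by
  rw [left_eq_single, right_eq_single, pairing_mapTensor_single, toDual_single_single]
  simp

theorem pairing_right_left (σ τ : Equiv.Perm (Fin 3)) (a b : Ω') (c d : Ω) :
    pairing (mapTensor (toDual ι) (right k σ a b)) (left k τ c d) = 0 := by
  rw [right_eq_single, left_eq_single, pairing_mapTensor_single, toDual_single_single]
  simp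

end dual

end BinQuadData

/-! ### The Koszul dual of the transposed `δ`-Leibniz–Poisson operad -/

section TLPDual

open BinQuadData

variable {k : Type u} [Field k]

instance : DecidableEq TLPOp := fun a b => by
  cases a <;> cases b <;> first | exact isTrue rfl | exact isFalse (by simp)

/-- The bijection between the operations of an operad and those of its Koszul dual. -/
def dualTLPOpEquiv : DualTLPOp ≃ TLPOp where
  toFun a := match a with | .mul => .mul | .star => .bracket
  invFun a := match a with | .mul => .mul | .bracket => .star
  left_inv a := by cases a <;> rfl
  right_inv a := by cases a <;> rfl

theorem dualTLPOpEquiv_mul : dualTLPOpEquiv .mul = .mul := rfl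

theorem dualTLPOpEquiv_star : dualTLPOpEquiv .star = .bracket := rfl

theorem sign_mul_sign (σ : Equiv.Perm (Fin 3)) :
    ((Equiv.Perm.sign σ : ℤ) : k) * ((Equiv.Perm.sign σ : ℤ) : k) = 1 := by
  rcases Int.units_eq_one_or (Equiv.Perm.sign σ) with h | h <;> simp [h]

/-! The identities are studied in an arbitrary module `M` with elements `L σ a b` and `R σ a b`
that stand for the monomials `left k σ a b` and `right k σ a b`. -/

section identities

variable {M : Type u} [AddCommGroup M] [Module k M]

/-- The defining identities of transposed `δ`-Leibniz–Poisson algebras. -/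
def tlpIdentities (δ : k) (L R : Equiv.Perm (Fin 3) → TLPOp → TLPOp → M) : Set M :=
  { L 1 .mul .mul - R 1 .mul .mul,
    L 1 .bracket .bracket - (R 1 .bracket .bracket - R (Equiv.swap 0 1) .bracket .bracket),
    δ • R 1 .mul .bracket - (L 1 .mul .bracket + R (Equiv.swap 0 1) .bracket .mul) }

/-- The identities of the Koszul dual algebras. -/
def dualTLPIdentities (δ : k) (L R : Equiv.Perm (Fin 3) → DualTLPOp → DualTLPOp → M) : Set M :=
  { L 1 .mul .mul - R 1 .mul .mul,
    R 1 .star .star - (L 1 .star .star + L (Equiv.swap 0 1) .star .star) } ∪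
  {r | δ ≠ 0 ∧ (r = R 1 .mul .star - δ • L 1 .mul .star ∨
    r = R 1 .mul .star - δ • R (Equiv.swap 0 1) .star .mul ∨ r = L 1 .star .mul)} ∪
  {r | δ = 0 ∧ (r = L 1 .star .mul ∨ r = R 1 .mul .star ∨
    r = R (Equiv.swap 0 1) .star .mul - L 1 .mul .star)}

/-! ### The identities, evaluated on a vector space with two operations. -/

section algebras

variable {V : Type v} [AddCommGroup V] [Module k V] (T : (Fin 3 → V) → M →ₗ[k] V)

/-- Here `T x` plays the role of evaluation at `x`; taking `x = ![x, y, z]` recovers the axioms from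
the formal identities. -/
theorem isTLP_iff (δ : k) {L R : Equiv.Perm (Fin 3) → TLPOp → TLPOp → M}
    {B : TLPOp → V →ₗ[k] V →ₗ[k] V}
    (hL : ∀ x σ a b, T x (L σ a b) = B b (B a (x (σ 0)) (x (σ 1))) (x (σ 2)))
    (hR : ∀ x σ a b, T x (R σ a b) = B a (x (σ 0)) (B b (x (σ 1)) (x (σ 2)))) :
    IsTLP δ (B .mul) (B .bracket) ↔ ∀ r ∈ tlpIdentities δ L R, ∀ x, T x r = 0 := by
  have hs : Equiv.swap (0 : Fin 3) 1 2 = 2 := by decide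
  constructor
  · rintro ⟨h1, h2, h3⟩ r (rfl | rfl | rfl) x
    · simp [hL, hR, h1]
    · simp [hL, hR, h2, hs]
    · simp [hL, hR, h3, hs]
  · intro hB
    have h1 := fun x y z => hB _ (Or.inl rfl) ![x, y, z]
    have h2 := fun x y z => hB _ (Or.inr (Or.inl rfl)) ![x, y, z]
    have h3 := fun x y z => hB _ (Or.inr (Or.inr rfl)) ![x, y, z]
    simp only [map_sub, map_add, map_smul, hL, hR, sub_eq_zero] at h1 h2 h3
    exact ⟨h1, h2, h3⟩

theorem isDualTLP_iff (δ : k) {L R : Equiv.Perm (Fin 3) → DualTLPOp → DualTLPOp → M}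
    {B : DualTLPOp → V →ₗ[k] V →ₗ[k] V}
    (hL : ∀ x σ a b, T x (L σ a b) = B b (B a (x (σ 0)) (x (σ 1))) (x (σ 2)))
    (hR : ∀ x σ a b, T x (R σ a b) = B a (x (σ 0)) (B b (x (σ 1)) (x (σ 2)))) :
    IsDualTLP δ (B .mul) (B .star) ↔ ∀ r ∈ dualTLPIdentities δ L R, ∀ x, T x r = 0 := by
  have hs : Equiv.swap (0 : Fin 3) 1 2 = 2 := by decide
  constructor
  · rintro ⟨h1, h2, h3, h4⟩ r
      (((rfl | rfl) | ⟨hδ, rfl | rfl | rfl⟩) | ⟨hδ, rfl | rfl | rfl⟩) x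
    · simp [hL, hR, h1]
    · simp [hL, hR, h2, hs]
    · simp [hL, hR, (h3 hδ _ _ _).1]
    · simpa [hL, hR, hs, sub_eq_zero] using (h3 hδ _ _ _).2.1
    · simp [hL, (h3 hδ _ _ _).2.2]
    · simp [hL, (h4 hδ _ _ _).1]
    · simp [hR, (h4 hδ _ _ _).2.1]
    · simp [hL, hR, hs, (h4 hδ _ _ _).2.2]
  · intro hB
    have h1 := fun x y z => hB _ (Or.inl (Or.inl (Or.inl rfl))) ![x, y, z]
    have h2 := fun x y z => hB _ (Or.inl (Or.inl (Or.inr rfl))) ![x, y, z]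
    have h3 := fun hδ x y z => hB _ (Or.inl (Or.inr ⟨hδ, Or.inl rfl⟩)) ![x, y, z]
    have h4 := fun hδ x y z => hB _ (Or.inl (Or.inr ⟨hδ, Or.inr (Or.inl rfl)⟩)) ![x, y, z]
    have h5 := fun hδ x y z => hB _ (Or.inl (Or.inr ⟨hδ, Or.inr (Or.inr rfl)⟩)) ![x, y, z]
    have h6 := fun hδ x y z => hB _ (Or.inr ⟨hδ, Or.inl rfl⟩) ![x, y, z]
    have h7 := fun hδ x y z => hB _ (Or.inr ⟨hδ, Or.inr (Or.inl rfl)⟩) ![x, y, z]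
    have h8 := fun hδ x y z => hB _ (Or.inr ⟨hδ, Or.inr (Or.inr rfl)⟩) ![x, y, z]
    simp only [map_sub, map_add, map_smul, hL, hR, sub_eq_zero] at h1 h2 h3 h4 h5 h6 h7 h8
    exact ⟨h1, h2, fun hδ x y z => ⟨h3 hδ x y z, h4 hδ x y z, h5 hδ x y z⟩,
      fun hδ x y z => ⟨h6 hδ x y z, h7 hδ x y z, h8 hδ x y z⟩⟩

end algebras

/-! ### The orthogonality computation. -/

variable {M' : Type u} [AddCommGroup M'] [Module k M']

/-- Brings the cases `δ = 0` and `δ ≠ 0` to one common list: `(x⋆y)z = 0`, `x(y⋆z) = δ (xy)⋆z` and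
`y⋆(xz) = (xy)⋆z`, next to associativity and the Zinbiel identity. The list serves as rewriting
rules towards the left monomials kept by `F` below. -/
theorem dualTLPIdentities_mem (δ : k) {L R : Equiv.Perm (Fin 3) → DualTLPOp → DualTLPOp → M}
    {act : Equiv.Perm (Fin 3) → M →ₗ[k] M}
    (actL : ∀ σ τ a b, act σ (L τ a b) = L (σ * τ) a b)
    (actR : ∀ σ τ a b, act σ (R τ a b) = R (σ * τ) a b) {W : Submodule k M}
    (hW : ∀ σ, ∀ r ∈ dualTLPIdentities δ L R, act σ r ∈ W) (σ : Equiv.Perm (Fin 3)) :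
    R σ .mul .mul - L σ .mul .mul ∈ W ∧
    R σ .star .star - (L σ .star .star + L (σ * Equiv.swap 0 1) .star .star) ∈ W ∧
    L σ .star .mul ∈ W ∧ R σ .mul .star - δ • L σ .mul .star ∈ W ∧
    R (σ * Equiv.swap 0 1) .star .mul - L σ .mul .star ∈ W := by
  refine ⟨?_, ?_, ?_⟩
  · simpa [actL, actR] using neg_mem (hW σ _ (Or.inl (Or.inl (Or.inl rfl))))
  · simpa [actL, actR] using hW σ _ (Or.inl (Or.inl (Or.inr rfl)))
  by_cases hδ : δ = 0
  · have h1 := hW σ _ (Or.inr ⟨hδ, Or.inl rfl⟩)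
    have h2 := hW σ _ (Or.inr ⟨hδ, Or.inr (Or.inl rfl)⟩)
    have h3 := hW σ _ (Or.inr ⟨hδ, Or.inr (Or.inr rfl)⟩)
    simp only [actL, actR, map_sub, mul_one] at h1 h2 h3
    exact ⟨h1, by simpa [hδ] using h2, h3⟩
  · have h1 := hW σ _ (Or.inl (Or.inr ⟨hδ, Or.inl rfl⟩))
    have h2 := hW σ _ (Or.inl (Or.inr ⟨hδ, Or.inr (Or.inl rfl)⟩))
    have h3 := hW σ _ (Or.inl (Or.inr ⟨hδ, Or.inr (Or.inr rfl)⟩))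
    simp only [actL, actR, map_sub, map_smul, mul_one] at h1 h2 h3
    refine ⟨h3, h1, ?_⟩
    -- The two expressions for `x(y⋆z)` differ by `δ (y⋆(xz) - (xy)⋆z)`, and `δ` can be cancelled.
    have h4 := W.smul_mem δ⁻¹ (sub_mem h1 h2)
    rwa [sub_sub_sub_cancel_left, ← smul_sub, smul_smul, inv_mul_cancel₀ hδ, one_smul] at h4

variable {L R : Equiv.Perm (Fin 3) → TLPOp → TLPOp → M}
  {L' R' : Equiv.Perm (Fin 3) → DualTLPOp → DualTLPOp → M'}
  {act : Equiv.Perm (Fin 3) → M →ₗ[k] M} {act' : Equiv.Perm (Fin 3) → M' →ₗ[k] M'}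
  {p : M' →ₗ[k] M →ₗ[k] k}

/-- The dual identities are orthogonal to the identities of transposed Leibniz–Poisson algebras. -/
theorem dualTLPIdentities_orth (δ : k)
    (actL : ∀ σ τ a b, act σ (L τ a b) = L (σ * τ) a b)
    (actR : ∀ σ τ a b, act σ (R τ a b) = R (σ * τ) a b)
    (hLL : ∀ σ τ a b c d, p (L' σ a b) (L τ c d) =
      if σ = τ ∧ dualTLPOpEquiv a = c ∧ dualTLPOpEquiv b = d
        then ((Equiv.Perm.sign σ : ℤ) : k) else 0)
    (hRR : ∀ σ τ a b c d, p (R' σ a b) (R τ c d) =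
      if σ = τ ∧ dualTLPOpEquiv a = c ∧ dualTLPOpEquiv b = d
        then -((Equiv.Perm.sign σ : ℤ) : k) else 0)
    (hLR : ∀ σ τ a b c d, p (L' σ a b) (R τ c d) = 0)
    (hRL : ∀ σ τ a b c d, p (R' σ a b) (L τ c d) = 0)
    {y : M'} (hy : y ∈ dualTLPIdentities δ L' R') (τ : Equiv.Perm (Fin 3)) {r : M}
    (hr : r ∈ tlpIdentities δ L R) : p y (act τ r) = 0 := by
  -- Only the permutations `1` and `swap 0 1` occur in `y`, and only `τ` and `τ * swap 0 1` in `act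
  -- τ r`. So all pairings vanish term by term unless `τ` is `1` or `swap 0 1`; these two cases are
  -- compared by hand.
  have hs : (1 : Equiv.Perm (Fin 3)) ≠ Equiv.swap 0 1 := by decide
  have h1 : ∀ ρ : Equiv.Perm (Fin 3), 1 = ρ * Equiv.swap 0 1 ↔ Equiv.swap 0 1 = ρ := by decide
  have h2 : ∀ ρ : Equiv.Perm (Fin 3), Equiv.swap 0 1 = ρ * Equiv.swap 0 1 ↔ 1 = ρ := by decide
  have hsign : Equiv.Perm.sign (Equiv.swap (0 : Fin 3) 1) = -1 := by decide
  rcases hy with ((rfl | rfl) | ⟨hδ, rfl | rfl | rfl⟩) | ⟨hδ, rfl | rfl | rfl⟩ <;>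
  rcases hr with rfl | rfl | rfl <;>
  simp [actL, actR, hLL, hRR, hLR, hRL, dualTLPOpEquiv_mul, dualTLPOpEquiv_star, h1, h2, hsign] <;>
  by_cases e1 : 1 = τ <;> by_cases e2 : Equiv.swap 0 1 = τ <;> simp_all

/-- Conversely, everything orthogonal to the identities of transposed Leibniz–Poisson algebras
follows from the dual identities. -/
theorem mem_of_orth_tlpIdentities (δ : k)
    (actL : ∀ σ τ a b, act σ (L τ a b) = L (σ * τ) a b)
    (actR : ∀ σ τ a b, act σ (R τ a b) = R (σ * τ) a b)
    (actL' : ∀ σ τ a b, act' σ (L' τ a b) = L' (σ * τ) a b)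
    (actR' : ∀ σ τ a b, act' σ (R' τ a b) = R' (σ * τ) a b)
    (hLL : ∀ σ τ a b c d, p (L' σ a b) (L τ c d) =
      if σ = τ ∧ dualTLPOpEquiv a = c ∧ dualTLPOpEquiv b = d
        then ((Equiv.Perm.sign σ : ℤ) : k) else 0)
    (hRR : ∀ σ τ a b c d, p (R' σ a b) (R τ c d) =
      if σ = τ ∧ dualTLPOpEquiv a = c ∧ dualTLPOpEquiv b = d
        then -((Equiv.Perm.sign σ : ℤ) : k) else 0)
    (hLR : ∀ σ τ a b c d, p (L' σ a b) (R τ c d) = 0)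
    (hRL : ∀ σ τ a b c d, p (R' σ a b) (L τ c d) = 0)
    (hspan : ∀ f : M' →ₗ[k] M', ∀ W : Submodule k M', (∀ σ a b, f (L' σ a b) ∈ W) →
      (∀ σ a b, f (R' σ a b) ∈ W) → ∀ y, f y ∈ W)
    {W : Submodule k M'} (hW : ∀ σ, ∀ r ∈ dualTLPIdentities δ L' R', act' σ r ∈ W)
    {y : M'} (hy : ∀ τ, ∀ r ∈ tlpIdentities δ L R, p y (act τ r) = 0) : y ∈ W := by
  let u (τ : Equiv.Perm (Fin 3)) : M := L τ .mul .mul - R τ .mul .mul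
  let v (τ : Equiv.Perm (Fin 3)) : M := L τ .bracket .bracket -
    (R τ .bracket .bracket - R (τ * Equiv.swap 0 1) .bracket .bracket)
  let w (τ : Equiv.Perm (Fin 3)) : M :=
    δ • R τ .mul .bracket - (L τ .mul .bracket + R (τ * Equiv.swap 0 1) .bracket .mul)
  have hu : ∀ τ, p y (u τ) = 0 := fun τ => by simpa [u, actL, actR] using hy τ _ (Or.inl rfl)
  have hv : ∀ τ, p y (v τ) = 0 := fun τ => by
    simpa [v, actL, actR] using hy τ _ (Or.inr (Or.inl rfl))
  have hw : ∀ τ, p y (w τ) = 0 := fun τ => by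
    simpa [w, actL, actR] using hy τ _ (Or.inr (Or.inr rfl))
  -- `F` is the reduction to the left monomials `(xy)z`, `(x⋆y)⋆z` and `(xy)⋆z`. The factor `sign τ`
  -- normalizes the diagonal pairing, and the last term carries a minus sign because `{xy,z}` has
  -- coefficient `-1` in `w`. Thus `F` fixes these three families of monomials.
  let F : M' →ₗ[k] M' := ∑ τ, ((Equiv.Perm.sign τ : ℤ) : k) •
    ((p.flip (u τ)).smulRight (L' τ .mul .mul) + (p.flip (v τ)).smulRight (L' τ .star .star) -
      (p.flip (w τ)).smulRight (L' τ .mul .star))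
  have hF : F y = 0 := by simp [F, hu, hv, hw]
  have hFe : ∀ z, F z = ∑ τ, ((Equiv.Perm.sign τ : ℤ) : k) •
    (p z (u τ) • L' τ .mul .mul + p z (v τ) • L' τ .star .star -
      p z (w τ) • L' τ .mul .star) := fun z => by simp [F]
  have hs1 : ∀ σ τ : Equiv.Perm (Fin 3), σ = τ * Equiv.swap 0 1 ↔ σ * Equiv.swap 0 1 = τ := by
    decide
  have hs2 : ∀ σ : Equiv.Perm (Fin 3), Equiv.Perm.sign (σ * Equiv.swap 0 1) =
    -Equiv.Perm.sign σ := by decide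
  have hmem := dualTLPIdentities_mem δ actL' actR' hW
  -- On each monomial, `id - F` is zero or one of the rewriting rules of `dualTLPIdentities_mem`.
  have key : ∀ y, (LinearMap.id - F : M' →ₗ[k] M') y ∈ W := by
    refine hspan _ W ?_ ?_
    · rintro σ (_ | _) (_ | _)
      all_goals
        simp only [LinearMap.sub_apply, LinearMap.id_apply, hFe]
        simp [u, v, w, hLL, hLR, dualTLPOpEquiv_mul, dualTLPOpEquiv_star, smul_smul,
          sign_mul_sign, (hmem σ).2.2.1]
    · have hsub := (hmem · |>.2.2.2.2)
      rintro σ (_ | _) (_ | _)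
      all_goals
        simp only [LinearMap.sub_apply, LinearMap.id_apply, hFe]
        simp [u, v, w, hRR, hRL, dualTLPOpEquiv_mul, dualTLPOpEquiv_star, smul_smul,
          sign_mul_sign, (hmem σ).1, hs1, hs2]
      -- The monomial `x(y⋆z)` is reduced to `δ (xy)⋆z`.
      · rw [mul_left_comm, sign_mul_sign, mul_one]
        exact (hmem σ).2.2.2.1
      -- The monomial `x⋆(yz)` is reduced to `(yx)⋆z`: the rule is used with the first two variables
      -- exchanged.
      · have h := hsub (σ * Equiv.swap 0 1)
        rwa [mul_assoc, Equiv.swap_mul_self, mul_one] at h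
      -- The monomial `x⋆(y⋆z)` meets two of the relations `v`. The opposite signs of `σ` and `σ *
      -- swap 0 1` turn the minus of the Leibniz identity into the plus of the Zinbiel identity.
      · simpa [mul_sub, sub_smul, ite_smul, hs2, sign_mul_sign, add_comm] using (hmem σ).2.1
  simpa [hF] using key y

/-- The dual identities generate the orthogonal complement of the identities of transposed
Leibniz–Poisson algebras. -/
theorem mem_span_dualTLPIdentities_iff (δ : k)
    (actL : ∀ σ τ a b, act σ (L τ a b) = L (σ * τ) a b)
    (actR : ∀ σ τ a b, act σ (R τ a b) = R (σ * τ) a b)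
    (actL' : ∀ σ τ a b, act' σ (L' τ a b) = L' (σ * τ) a b)
    (actR' : ∀ σ τ a b, act' σ (R' τ a b) = R' (σ * τ) a b)
    (hLL : ∀ σ τ a b c d, p (L' σ a b) (L τ c d) =
      if σ = τ ∧ dualTLPOpEquiv a = c ∧ dualTLPOpEquiv b = d
        then ((Equiv.Perm.sign σ : ℤ) : k) else 0)
    (hRR : ∀ σ τ a b c d, p (R' σ a b) (R τ c d) =
      if σ = τ ∧ dualTLPOpEquiv a = c ∧ dualTLPOpEquiv b = d
        then -((Equiv.Perm.sign σ : ℤ) : k) else 0)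
    (hLR : ∀ σ τ a b c d, p (L' σ a b) (R τ c d) = 0)
    (hRL : ∀ σ τ a b c d, p (R' σ a b) (L τ c d) = 0)
    (hp : ∀ σ τ y r, p (act' σ y) (act τ r) =
      ((Equiv.Perm.sign σ : ℤ) : k) * p y (act (σ⁻¹ * τ) r))
    (hspan : ∀ f : M' →ₗ[k] M', ∀ W : Submodule k M', (∀ σ a b, f (L' σ a b) ∈ W) →
      (∀ σ a b, f (R' σ a b) ∈ W) → ∀ y, f y ∈ W) (y : M') :
    (∀ r ∈ Submodule.span k {x | ∃ σ, ∃ r ∈ tlpIdentities δ L R, x = act σ r}, p y r = 0) ↔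
      y ∈ Submodule.span k {x | ∃ σ, ∃ r ∈ dualTLPIdentities δ L' R', x = act' σ r} := by
  constructor
  · intro h
    refine mem_of_orth_tlpIdentities δ actL actR actL' actR' hLL hRR hLR hRL hspan
      (fun σ r hr => Submodule.subset_span ?_)
      fun τ r hr => h _ (Submodule.subset_span ⟨τ, r, hr, rfl⟩)
    exact ⟨σ, r, hr, rfl⟩
  · intro hy r hr
    -- By bilinearity it suffices to pair generators of the two spans; `hp` then moves the
    -- relabelling of the dual identity onto the other argument.
    refine (Submodule.span_le (p := LinearMap.ker (p y))).2 ?_ hr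
    rintro _ ⟨τ, r, hr, rfl⟩
    refine (Submodule.span_le (p := LinearMap.ker (p.flip (act τ r)))).2 ?_ hy
    rintro _ ⟨σ, y, hy, rfl⟩
    change p (act' σ y) (act τ r) = 0
    rw [hp, dualTLPIdentities_orth δ actL actR hLL hRR hLR hRL hy _ hr, mul_zero]

end identities

/-! ### Application to the two concrete operads. -/

theorem algebrasAre_tlp (δ : k) (V : Type v) [AddCommGroup V] [Module k V] :
    (tlpData δ).operad.AlgebrasAre ((tlpData δ).gen (tlpMul δ)) ((tlpData δ).gen (tlpBracket δ))
      V (IsTLP δ) := by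
  refine algebrasAre_ofIdentities _ TLPOp.mul TLPOp.bracket
    (fun f g h h' => funext fun c => by cases c <;> assumption) fun m s => ?_
  have h (B : TLPOp → V →ₗ[k] V →ₗ[k] V) := isTLP_iff (evalTensor (regEval B)) δ
    (evalTensor_left B) (evalTensor_right B)
  constructor
  · intro hms
    exact ⟨fun a => match a with | .mul => m | .bracket => s, rfl, rfl, (h _).1 hms⟩
  · rintro ⟨B, rfl, rfl, hB⟩
    exact (h B).2 hB

theorem algebrasAre_dualTLP (δ : k) (V : Type v) [AddCommGroup V] [Module k V] :
    (dualTLPData δ).operad.AlgebrasAre ((dualTLPData δ).gen (op k DualTLPOp.mul))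
      ((dualTLPData δ).gen (op k DualTLPOp.star)) V (IsDualTLP δ) := by
  refine algebrasAre_ofIdentities _ DualTLPOp.mul DualTLPOp.star
    (fun f g h h' => funext fun c => by cases c <;> assumption) fun m s => ?_
  have h (B : DualTLPOp → V →ₗ[k] V →ₗ[k] V) := isDualTLP_iff (evalTensor (regEval B)) δ
    (evalTensor_left B) (evalTensor_right B)
  constructor
  · intro hms
    exact ⟨fun a => match a with | .mul => m | .star => s, rfl, rfl, (h _).1 hms⟩
  · rintro ⟨B, rfl, rfl, hB⟩
    exact (h B).2 hB

/-- The monomials span; this is the form in which the hypothesis `hspan` of the orthogonality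
computation asks for it. -/
theorem apply_mem_of_monomials {Ω : Type} {N : Type*} [AddCommGroup N] [Module k N]
    (f : (Fin 3 → RegE k Ω ⊗[k] RegE k Ω) →ₗ[k] N) (W : Submodule k N)
    (hl : ∀ σ a b, f (left k σ a b) ∈ W) (hr : ∀ σ a b, f (right k σ a b) ∈ W)
    (y : Fin 3 → RegE k Ω ⊗[k] RegE k Ω) : f y ∈ W := by
  have : W.mkQ ∘ₗ f = 0 := linearMap_ext_monomials
    (fun σ a b => (Submodule.Quotient.mk_eq_zero W).2 (hl σ a b))
    (fun σ a b => (Submodule.Quotient.mk_eq_zero W).2 (hr σ a b))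
  exact (Submodule.Quotient.mk_eq_zero W).1 (LinearMap.congr_fun this y)

/-- Since `toDual` is equivariant, this is the invariance of the canonical pairing up to sign,
applied after factoring `τ` as `σ * (σ⁻¹ * τ)`. -/
theorem pairing_mapTensor_cubicAct (σ τ : Equiv.Perm (Fin 3))
    (y : Fin 3 → RegE k DualTLPOp ⊗[k] RegE k DualTLPOp)
    (r : Fin 3 → RegE k TLPOp ⊗[k] RegE k TLPOp) :
    pairing (mapTensor (toDual dualTLPOpEquiv) (cubicAct (regSwap k DualTLPOp) σ y))
      (cubicAct (regSwap k TLPOp) τ r) = ((Equiv.Perm.sign σ : ℤ) : k) *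
        pairing (mapTensor (toDual dualTLPOpEquiv) y)
          (cubicAct (regSwap k TLPOp) (σ⁻¹ * τ) r) := by
  rw [mapTensor_cubicAct _ (toDual_swap dualTLPOpEquiv),
    ← pairing_act (regSwap k TLPOp) (regSwap_regSwap TLPOp),
    ← cubicAct_mul _ (regSwap_regSwap TLPOp), mul_inv_cancel_left]

/-- The heart of the presentation: under the identification of generators by `toDual`, the
complement `R^⊥` is precisely the span of the relabelled dual identities. -/
theorem mapTensor_mem_orth_iff (δ : k) (y : Fin 3 → RegE k DualTLPOp ⊗[k] RegE k DualTLPOp) :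
    mapTensor (toDual dualTLPOpEquiv) y ∈ (tlpData δ).koszulDual.R ↔ y ∈ (dualTLPData δ).R := by
  have h := mem_span_dualTLPIdentities_iff (L := left k) (R := right k) (L' := left k)
    (R' := right k) (act := cubicAct (regSwap k TLPOp)) (act' := cubicAct (regSwap k DualTLPOp))
    (p := pairing ∘ₗ mapTensor (toDual dualTLPOpEquiv)) δ
    cubicAct_left cubicAct_right cubicAct_left cubicAct_right
  have h := h (pairing_left_left dualTLPOpEquiv) (pairing_right_right dualTLPOpEquiv)
    (pairing_left_right dualTLPOpEquiv) (pairing_right_left dualTLPOpEquiv)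
    pairing_mapTensor_cubicAct
  exact h (apply_mem_of_monomials (k := k) (Ω := DualTLPOp)
    (N := Fin 3 → RegE k DualTLPOp ⊗[k] RegE k DualTLPOp)) y

theorem exists_isIso_koszulDual (δ : k) :
    ∃ f : SymOperad.Hom (dualTLPData δ).operad (tlpData δ).koszulDual.operad, f.IsIso ∧
      f.app (Fin 2) ((dualTLPData δ).gen (op k DualTLPOp.mul)) =
        (tlpData δ).koszulDual.gen (dualMul δ) ∧
      f.app (Fin 2) ((dualTLPData δ).gen (op k DualTLPOp.star)) =
        (tlpData δ).koszulDual.gen (dualStar δ) := by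
  obtain ⟨f, hf, hgen⟩ := exists_isIso (D := dualTLPData δ) (D' := (tlpData δ).koszulDual)
    (toDualEquiv dualTLPOpEquiv) (toDual_swap dualTLPOpEquiv) (mapTensor_mem_orth_iff δ)
  exact ⟨f, hf, (hgen _).trans (congrArg _ (toDual_op dualTLPOpEquiv .mul)),
    (hgen _).trans (congrArg _ (toDual_op dualTLPOpEquiv .star))⟩

end TLPDual

theorem mainTheorem11 {k : Type u} [Field k] [CharZero k] (δ : k) :
    -- the operad whose Koszul dual is taken governs the transposed `δ`-Leibniz–Poisson algebras
    (∀ (V : Type v) [AddCommGroup V] [Module k V],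
      (tlpData δ).operad.AlgebrasAre ((tlpData δ).gen (tlpMul δ)) ((tlpData δ).gen (tlpBracket δ))
        V (IsTLP δ)) ∧
    -- the algebras over its Koszul dual operad
    (∀ (V : Type v) [AddCommGroup V] [Module k V],
      (tlpData δ).koszulDual.operad.AlgebrasAre
        ((tlpData δ).koszulDual.gen (dualMul δ)) ((tlpData δ).koszulDual.gen (dualStar δ))
        V (IsDualTLP δ)) ∧
    -- the Koszul dual operad is presented by the two products and their identities
    (∃ f : SymOperad.Hom (dualTLPData δ).operad (tlpData δ).koszulDual.operad, f.IsIso ∧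
      f.app (Fin 2) ((dualTLPData δ).gen (BinQuadData.op k DualTLPOp.mul)) =
        (tlpData δ).koszulDual.gen (dualMul δ) ∧
      f.app (Fin 2) ((dualTLPData δ).gen (BinQuadData.op k DualTLPOp.star)) =
        (tlpData δ).koszulDual.gen (dualStar δ)) := by
  refine ⟨algebrasAre_tlp δ, fun V _ _ => ?_, exists_isIso_koszulDual δ⟩
  obtain ⟨f, hf, hmul, hstar⟩ := exists_isIso_koszulDual δ
  rw [← hmul, ← hstar]
  -- The algebras over the presented operad are known from its identities; the isomorphism matches
  -- the generators and carries the description over to the Koszul dual.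
  exact (algebrasAre_dualTLP δ V).of_isIso hf
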